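/- Let $(\psi_{lk})_{l\ge 0,\ 0\le k\le 2^l-1}$ be an orthonormal basis of $L^2[0,1]$ (for instance a boundary-corrected wavelet basis), and for $f\in L^2[0,1]$ write $f_{lk}=\langle f,\psi_{lk}\rangle$. Model. For $f\in L^2[0,1]$ and $n\ge 1$, let $P_f^{(n)}$ be the law of the observation sequence $X^{(n)}=(X_{lk})_{l,k}$ of the projected Gaussian white noise model: the $X_{lk}$ are independent with $X_{lk}\sim\mathcal N(f_{lk},1/n)$. Write $E_{f_0}$ for the expectation under $P_{f_0}^{(n)}$. Prior. Let $H$ be a probability law on $\mathbb R$ with a density $h$ that is symmetric, positive, bounded, decreasing on $[0,\infty)$, such that for some $c_1>0$ and $\kappa\ge 0$ $$\log(1/h(x))\le c_1\bigl(1+\log^{1+\kappa}(1+x)\bigr)\quad\text{for all } x\ge 0,$$ and with $\int_{\mathbb R} x^2h(x)\,dx<\infty$. For a sequence $(s_l)_{l\ge0}$ of positive scales, let the prior $\Pi$ be the law of $f=\sum_{l,k}s_l\zeta_{lk}\psi_{lk}$ with $\zeta_{lk}$ independent of common law $H$, and let $\Pi[\,\cdot\mid X^{(n)}]$ be the posterior,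 i.e. the conditional law of $f$ given $X^{(n)}$ when $f\sim\Pi$ and $X^{(n)}\mid f\sim P_f^{(n)}$. Theorem. Let $\beta,L>0$, $1\le r\le 2$ and $\beta>1/r-1/2$, and let $$\mathcal B^\beta_{rr}(L)=\Bigl\{f\in L^2[0,1]:\ \sum_{l\ge 0}2^{rl(\beta+1/2-1/r)}\sum_{k=0}^{2^l-1}|f_{lk}|^r<L^r\Bigr\}.$$ (i) For $s_l=2^{-l^2}$ there is $d>0$ such that for every $f_0\in\mathcal B^\beta_{rr}(L)$, as $n\to\infty$, $$E_{f_0}\Pi\bigl[\{f:\ \|f-f_0\|_2>(\log n)^d\,n^{-\beta/(2\beta+1)}\}\,\big|\,X^{(n)}\bigr]\to 0 .$$ (ii) For every $\alpha\ge\beta$, the same holds, with a possibly different $d>0$, for $s_l=2^{-l(1/2+\alpha)}$. -/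

import Mathlib

open MeasureTheory ProbabilityTheory Filter Topology
open scoped NNReal ENNReal

noncomputable section

/-- The real Hilbert space `L²[0,1]`. -/
abbrev L2I : Type := Lp ℝ 2 (volume.restrict (Set.Icc (0 : ℝ) 1))

instance L2I.instMeasurableSpace : MeasurableSpace L2I := borel L2I

instance L2I.instBorelSpace : BorelSpace L2I := ⟨rfl⟩

instance L2I.instSecondCountableTopology : SecondCountableTopology L2I := by
  have : Fact ((2 : ℝ≥0∞) ≠ ∞) := ⟨by simp⟩
  infer_instance

/-- Double indices `(l, k)` with level `l ≥ 0` and position `k ∈ {0, …, 2 ^ l - 1}`. -/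
abbrev WaveletIndex : Type := Σ l : ℕ, Fin (2 ^ l)

/-- An orthonormal basis `(ψ_{lk})` of `L²[0,1]` with double indices. -/
abbrev WaveletBasis : Type := HilbertBasis WaveletIndex ℝ L2I

/-- The coefficient `f_{lk} = ⟨f, ψ_{lk}⟩`. -/
def coeff (ψ : WaveletBasis) (f : L2I) (i : WaveletIndex) : ℝ := inner ℝ (ψ i) f

/-- The ball `B^β_{rr}(L)`: all `f` with
`∑_l 2 ^ (r l (β + 1/2 - 1/r)) ∑_k |f_{lk}| ^ r < L ^ r` (the series of nonnegative terms is
taken in `[0, ∞]`). -/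
def besovBall (ψ : WaveletBasis) (β r L : ℝ) : Set L2I :=
  {f | ∑' l : ℕ, ENNReal.ofReal
      ((2 : ℝ) ^ (r * l * (β + 1 / 2 - 1 / r)) * ∑ k : Fin (2 ^ l), |coeff ψ f ⟨l, k⟩| ^ r)
    < ENNReal.ofReal (L ^ r)}

/-- `h` is symmetric, positive, bounded, decreasing on `[0, ∞)`, and
`log (1 / h x) ≤ c₁ (1 + (log (1 + x)) ^ (1 + κ))` for `x ≥ 0`. -/
structure IsHeavyTailed (h : ℝ → ℝ) (c₁ κ : ℝ) : Prop where
  symm : ∀ x, h (-x) = h x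
  pos : ∀ x, 0 < h x
  bounded : ∃ M, ∀ x, h x ≤ M
  anti : AntitoneOn h (Set.Ici 0)
  tail : ∀ x, 0 ≤ x → Real.log (1 / h x) ≤ c₁ * (1 + (Real.log (1 + x)) ^ (1 + κ))

/-- The scales `s_l = 2 ^ (-l ^ 2)`. -/
def otScale (l : ℕ) : ℝ := (2 : ℝ) ^ (-(l : ℝ) ^ 2)

/-- The scales `s_l = 2 ^ (-l (1/2 + α))`. -/
def htScale (α : ℝ) (l : ℕ) : ℝ := (2 : ℝ) ^ (-(l : ℝ) * (1 / 2 + α))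

/-- The series prior: the law on `L²[0,1]` of `f = ∑_{l,k} s_l ζ_{lk} ψ_{lk}`, where the
`ζ_{lk}` are independent with common law `H`. -/
def seriesPrior (ψ : WaveletBasis) (s : ℕ → ℝ) (H : Measure ℝ) [IsProbabilityMeasure H] :
    Measure L2I :=
  (Measure.infinitePi fun _ : WaveletIndex => H).map
    fun ζ => ∑' i : WaveletIndex, (s i.1 * ζ i) • ψ i

theorem measurable_series (ψ : WaveletBasis) (s : ℕ → ℝ) :
    Measurable fun ζ : WaveletIndex → ℝ => ∑' i : WaveletIndex, (s i.1 * ζ i) • ψ i := by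
  have : MeasurableAdd₂ L2I := ⟨continuous_add.measurable⟩
  exact Measurable.tsum fun i =>
    ((continuous_const.mul (continuous_apply i)).smul continuous_const).measurable

instance seriesPrior.instIsProbabilityMeasure (ψ : WaveletBasis) (s : ℕ → ℝ) (H : Measure ℝ)
    [IsProbabilityMeasure H] : IsProbabilityMeasure (seriesPrior ψ s H) :=
  Measure.isProbabilityMeasure_map (measurable_series ψ s).aemeasurable

/-- The law of the observations `X = (X_{lk})` given `f`: independent `X_{lk} ∼ N(f_{lk}, 1/n)`. -/
def obsLaw (ψ : WaveletBasis) (n : ℕ) (f : L2I) : Measure (WaveletIndex → ℝ) :=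
  Measure.infinitePi fun i => gaussianReal (coeff ψ f i) (n : ℝ≥0)⁻¹

instance obsLaw.instIsProbabilityMeasure (ψ : WaveletBasis) (n : ℕ) (f : L2I) :
    IsProbabilityMeasure (obsLaw ψ n f) := by
  unfold obsLaw; infer_instance

theorem measurable_obsLaw (ψ : WaveletBasis) (n : ℕ) : Measurable (obsLaw ψ n) := by
  have hg : Measurable fun p : L2I × (WaveletIndex → ℝ) =>
      (fun i => coeff ψ p.1 i + p.2 i : WaveletIndex → ℝ) := by
    refine measurable_pi_lambda _ fun i => ?_
    have h1 : Measurable fun f : L2I => coeff ψ f i := by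
      unfold coeff
      exact (continuous_const.inner continuous_id).measurable
    exact (h1.comp measurable_fst).add ((measurable_pi_apply i).comp measurable_snd)
  have key : obsLaw ψ n = fun f => ((Kernel.id ×ₖ Kernel.const L2I
      (Measure.infinitePi fun _ : WaveletIndex => gaussianReal 0 (n : ℝ≥0)⁻¹)).map
      fun p : L2I × (WaveletIndex → ℝ) =>
        (fun i => coeff ψ p.1 i + p.2 i : WaveletIndex → ℝ)) f := by
    funext f
    rw [Kernel.map_apply _ hg, Kernel.prod_apply, Kernel.id_apply, Kernel.const_apply,
      Measure.dirac_prod, Measure.map_map hg (by fun_prop)]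
    have := Measure.infinitePi_map_pi
      (μ := fun _ : WaveletIndex => gaussianReal 0 (n : ℝ≥0)⁻¹)
      (f := fun i x => coeff ψ f i + x) (fun i => by fun_prop)
    unfold obsLaw
    simp only [gaussianReal_map_const_add, zero_add] at this
    exact this.symm
  rw [key]
  exact Kernel.measurable _

/-- The projected white noise model as a Markov kernel `f ↦ P_f^{(n)}`. -/
def whiteNoise (ψ : WaveletBasis) (n : ℕ) : Kernel L2I (WaveletIndex → ℝ) :=
  ⟨obsLaw ψ n, measurable_obsLaw ψ n⟩

instance whiteNoise.instIsMarkovKernel (ψ : WaveletBasis) (n : ℕ) :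
    IsMarkovKernel (whiteNoise ψ n) :=
  ⟨fun f => obsLaw.instIsProbabilityMeasure ψ n f⟩

/-- `E_{f₀} Π[{f : ‖f - f₀‖₂ > ε} | X^{(n)}]`, the expected posterior mass far from `f₀`. -/
def expectedPosteriorMass (ψ : WaveletBasis) (s : ℕ → ℝ) (H : Measure ℝ)
    [IsProbabilityMeasure H] (n : ℕ) (f₀ : L2I) (ε : ℝ) : ℝ≥0∞ :=
  ∫⁻ x, posterior (whiteNoise ψ n) (seriesPrior ψ s H) x {f | ‖f - f₀‖ > ε} ∂(obsLaw ψ n f₀)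

end

/-! ### Densities and absolute continuity of infinite product measures. -/

section ProductMeasures

variable {ι : Type*} {X : ι → Type*} {mX : ∀ i, MeasurableSpace (X i)}

/-! Prior and noise are both product laws, so the posterior expectation of a function of one
coefficient is a one-dimensional Bayes formula in the matching observation
(`ae_lintegral_posterior_coeff_eq`). This holds almost surely under the Bayesian marginal, and
transfers to the law at `f₀` because that law is absolutely continuous with respect to the marginal.
By Parseval and Markov's inequality, contraction then reduces to summing coordinatewise quadratic
posterior risks on the event that every noise variable lies within a truncation radius
(`expectedPosteriorMass_le`).

Two risk bounds suffice. For a bounded coefficient, the heavy tail leaves prior mass at least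
exp(-polylog) near the truth even when the scale is far too small; the posterior therefore stays
within polylog/√n of it, with risk polylog/n (`coordPosterior_sq_sub_le`). For a coefficient `a`
below roughly 1/√n, at a level where `s √n` is bounded, the evidence dominates the data density up
to a constant; on average the posterior second moment is at most a constant times the prior one, and
the risk is of order `a² + s²` (`setLIntegral_coordPosterior_sq_sub_le`).

Let N = n^(1/(2β+1)), so that N/n is the squared rate. Levels with 2^l < N have fewer than N
coefficients each and cost polylog/n per coefficient. At higher levels the Besov bound allows at
most N·polylog large coefficients per level, and only at O(log n) levels; the small ones contribute
squared sums of order N/n, and the terms `s²` sum geometrically to N/n. The total risk is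
polylog·N/n (`exists_tsum_truncated_risk_le`). Only an upper bound 2^(-l(1/2+β)) and an at most
quadratic decay of log `s_l` are used, so both families of scales are covered at once. -/

theorem lintegral_infinitePi_prod (μ : ∀ i, Measure (X i)) [∀ i, IsProbabilityMeasure (μ i)]
    (s : Finset ι) {g : ∀ i, X i → ℝ≥0∞} (hg : ∀ i, Measurable (g i)) :
    ∫⁻ x, ∏ i ∈ s, g i (x i) ∂(Measure.infinitePi μ) = ∏ i ∈ s, ∫⁻ y, g i y ∂(μ i) := by
  rw [lintegral_prod_eq_prod_lintegral_of_indepFun s (fun i (x : ∀ i, X i) => g i (x i))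
    (iIndepFun_infinitePi (P := μ) (X := g) hg) (fun i => (hg i).comp (measurable_pi_apply i))]
  refine Finset.prod_congr rfl fun i _ => ?_
  rw [← Measure.infinitePi_map_eval μ i, lintegral_map (hg i) (measurable_pi_apply i)]

theorem infinitePi_cylinder_eq_setLIntegral_prod (P Q : ∀ i, Measure (X i))
    [∀ i, IsProbabilityMeasure (P i)] [∀ i, IsProbabilityMeasure (Q i)]
    {z : ∀ i, X i → ℝ≥0∞} (hz : ∀ i, Measurable (z i)) (hPQ : ∀ i, P i = (Q i).withDensity (z i))
    (F : Finset ι) {S : Set (∀ i : F, X i)} (hS : MeasurableSet S) :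
    Measure.infinitePi P (cylinder F S)
      = ∫⁻ x in cylinder F S, ∏ i ∈ F, z i (x i) ∂(Measure.infinitePi Q) := by
  classical
  have hZ : Measurable fun x : ∀ i, X i => ∏ i ∈ F, z i (x i) :=
    Finset.measurable_prod _ fun i _ => (hz i).comp (measurable_pi_apply i)
  have key : (Measure.infinitePi P).map F.restrict
      = ((Measure.infinitePi Q).withDensity fun x => ∏ i ∈ F, z i (x i)).map F.restrict := by
    rw [Measure.infinitePi_map_restrict]
    refine (Measure.pi_eq fun t ht => ?_)
    have hbox : MeasurableSet (F.restrict ⁻¹' (Set.univ.pi t) : Set (∀ i, X i)) :=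
      (Finset.measurable_restrict F) (MeasurableSet.univ_pi ht)
    rw [Measure.map_apply (Finset.measurable_restrict F) (.univ_pi ht),
      withDensity_apply _ hbox, ← lintegral_indicator hbox]
    let g : ∀ i, X i → ℝ≥0∞ := fun i y => if h : i ∈ F then (t ⟨i, h⟩).indicator (z i) y else 1
    have hg : ∀ i, Measurable (g i) := by
      intro i
      by_cases h : i ∈ F
      · simp only [g, h, dif_pos]; exact (hz i).indicator (ht _)
      · simp only [g, h, dif_neg, not_false_iff]; exact measurable_const
    have e : ∀ x : ∀ i, X i, (F.restrict ⁻¹' (Set.univ.pi t)).indicator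
        (fun x : ∀ i, X i => ∏ i ∈ F, z i (x i)) x = ∏ i ∈ F, g i (x i) := by
      intro x
      by_cases hx : x ∈ F.restrict ⁻¹' (Set.univ.pi t)
      · rw [Set.indicator_of_mem hx]
        refine Finset.prod_congr rfl fun i hi => ?_
        have : x i ∈ t ⟨i, hi⟩ := hx ⟨i, hi⟩ (Set.mem_univ _)
        simp [g, hi, this]
      · rw [Set.indicator_of_notMem hx]
        have : ∃ i : F, x i ∉ t i := by
          by_contra! hc
          exact hx fun i _ => hc i
        obtain ⟨i, hi⟩ := this
        refine (Finset.prod_eq_zero i.2 ?_).symm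
        simp [g, hi]
    simp_rw [e]
    rw [lintegral_infinitePi_prod Q F hg, ← Finset.prod_coe_sort]
    refine Finset.prod_congr rfl fun i _ => ?_
    rw [hPQ i, withDensity_apply _ (ht i), ← lintegral_indicator (ht i)]
    simp [g]
  have hm : MeasurableSet (cylinder F S : Set (∀ i, X i)) := hS.cylinder F
  have := DFunLike.congr_fun key S
  rw [cylinder] at hm ⊢
  rw [Measure.map_apply (Finset.measurable_restrict F) hS,
    Measure.map_apply (Finset.measurable_restrict F) hS, withDensity_apply _ hm] at this
  exact this

/-- A uniform second moment bound on the finite-dimensional densities makes them uniformly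
integrable. From Z ≤ K + Z²/K one gets P(t) ≤ K Q(t) + C/K on cylinders; approximating a Q-null set
by cylinders and letting K tend to infinity gives P-measure zero. -/
theorem infinitePi_absolutelyContinuous (P Q : ∀ i, Measure (X i))
    [∀ i, IsProbabilityMeasure (P i)] [∀ i, IsProbabilityMeasure (Q i)]
    {z : ∀ i, X i → ℝ≥0∞} (hz : ∀ i, Measurable (z i)) (hPQ : ∀ i, P i = (Q i).withDensity (z i))
    {C : ℝ≥0} (hC : ∀ F : Finset ι, ∏ i ∈ F, ∫⁻ y, z i y ^ 2 ∂(Q i) ≤ C) :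
    Measure.infinitePi P ≪ Measure.infinitePi Q := by
  have hcyl : ∀ t ∈ measurableCylinders X, ∀ K : ℝ≥0, K ≠ 0 →
      Measure.infinitePi P t ≤ K * Measure.infinitePi Q t + C / K := by
    intro t ht K hK
    obtain ⟨F, S, hS, rfl⟩ := (mem_measurableCylinders t).1 ht
    have hm : MeasurableSet (cylinder F S : Set (∀ i, X i)) := hS.cylinder F
    rw [infinitePi_cylinder_eq_setLIntegral_prod P Q hz hPQ F hS]
    have hZ : Measurable fun x : ∀ i, X i => ∏ i ∈ F, z i (x i) :=
      Finset.measurable_prod _ fun i _ => (hz i).comp (measurable_pi_apply i)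
    have hK' : (K : ℝ≥0∞) ≠ 0 := by exact_mod_cast hK
    calc ∫⁻ x in cylinder F S, ∏ i ∈ F, z i (x i) ∂(Measure.infinitePi Q)
        ≤ ∫⁻ x in cylinder F S, (K + (∏ i ∈ F, z i (x i)) ^ 2 / K) ∂(Measure.infinitePi Q) := by
          refine lintegral_mono fun x => ?_
          set Z := ∏ i ∈ F, z i (x i)
          rcases le_total Z K with h | h
          · exact h.trans le_self_add
          · refine le_trans ?_ le_add_self
            rw [ENNReal.le_div_iff_mul_le (.inl hK') (.inl ENNReal.coe_ne_top), pow_two]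
            gcongr
      _ = K * Measure.infinitePi Q (cylinder F S)
          + ∫⁻ x in cylinder F S, (∏ i ∈ F, z i (x i)) ^ 2 / K ∂(Measure.infinitePi Q) := by
          rw [lintegral_add_left measurable_const, setLIntegral_const]
      _ ≤ _ := by
          gcongr
          calc _ ≤ ∫⁻ x, (∏ i ∈ F, z i (x i)) ^ 2 / K ∂(Measure.infinitePi Q) :=
                setLIntegral_le_lintegral _ _
            _ = (∫⁻ x, ∏ i ∈ F, z i (x i) ^ 2 ∂(Measure.infinitePi Q)) / K := by
                simp_rw [← Finset.prod_pow, ENNReal.div_eq_inv_mul]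
                rw [lintegral_const_mul]
                exact Finset.measurable_prod _ fun i _ =>
                  ((hz i).comp (measurable_pi_apply i)).pow_const 2
            _ ≤ C / K := by
                rw [lintegral_infinitePi_prod Q F (g := fun i y => z i y ^ 2)
                  fun i => (hz i).pow_const 2]
                gcongr
                exact hC F
  refine Measure.AbsolutelyContinuous.mk fun s hs hQs => ?_
  have hbound : ∀ K : ℝ≥0, K ≠ 0 → Measure.infinitePi P s ≤ C / K := by
    intro K hK
    refine ENNReal.le_of_forall_pos_le_add fun ε hε _ => ?_
    -- Chosen so that the approximation errors K δ under Q and δ under P add up to ε.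
    set δ : ℝ≥0 := ε / (K + 1)
    have hδ : (0 : ℝ≥0∞) < δ := by
      have : 0 < δ := by positivity
      exact_mod_cast this
    obtain ⟨t, ht, htd⟩ := exists_measure_symmDiff_lt_of_generateFrom_isSetRing
      (μ := Measure.infinitePi P + Measure.infinitePi Q) (C := measurableCylinders X)
      isSetRing_measurableCylinders
      ⟨{Set.univ}, Set.countable_singleton _, by
        simpa using univ_mem_measurableCylinders X, by simp⟩
      generateFrom_measurableCylinders.symm hs hδ
    rw [Measure.add_apply] at htd
    have hP : Measure.infinitePi P s ≤ Measure.infinitePi P t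
        + Measure.infinitePi P (symmDiff t s) := by
      refine (measure_mono ?_).trans (measure_union_le _ _)
      intro x hx
      by_cases hxt : x ∈ t
      · exact .inl hxt
      · exact .inr (.inr ⟨hx, hxt⟩)
    have hQ : Measure.infinitePi Q t ≤ Measure.infinitePi Q s
        + Measure.infinitePi Q (symmDiff t s) := by
      refine (measure_mono ?_).trans (measure_union_le _ _)
      intro x hx
      by_cases hxt : x ∈ s
      · exact .inl hxt
      · exact .inr (.inl ⟨hx, hxt⟩)
    rw [hQs, zero_add] at hQ
    calc Measure.infinitePi P s
        ≤ (K * Measure.infinitePi Q t + C / K) + Measure.infinitePi P (symmDiff t s) :=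
          hP.trans (by gcongr; exact hcyl t ht K hK)
      _ ≤ (K * δ + C / K) + δ := by
          gcongr
          · exact hQ.trans (le_add_self.trans htd.le)
          · exact le_self_add.trans htd.le
      _ = C / K + ε := by
          have : (K : ℝ≥0∞) * δ + δ = ε := by
            have : K * δ + δ = ε := by
              simp only [δ]; field_simp
            exact_mod_cast this
          rw [← this]; ring
  have hlim : Tendsto (fun K : ℕ => (C : ℝ≥0∞) / (K : ℝ≥0∞)) atTop (𝓝 0) := by
    have := ENNReal.Tendsto.const_mul (a := (C : ℝ≥0∞)) ENNReal.tendsto_inv_nat_nhds_zero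
      (.inr ENNReal.coe_ne_top)
    simpa [ENNReal.div_eq_inv_mul, mul_comm] using this
  refine le_antisymm (ge_of_tendsto hlim ?_) zero_le
  filter_upwards [eventually_gt_atTop 0] with K hK
  simpa using hbound (K : ℝ≥0) (by exact_mod_cast hK.ne')

end ProductMeasures

/-! ### Likelihood ratios of shifted Gaussians. -/

section GaussianShift

theorem measurable_likelihoodRatio (a b : ℝ) (v : ℝ≥0) :
    Measurable fun x => gaussianPDF a v x / gaussianPDF b v x :=
  (measurable_gaussianPDF a v).div (measurable_gaussianPDF b v)

theorem gaussianReal_eq_withDensity_shift (a b : ℝ) {v : ℝ≥0} (hv : v ≠ 0) :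
    gaussianReal a v
      = (gaussianReal b v).withDensity fun x => gaussianPDF a v x / gaussianPDF b v x := by
  rw [gaussianReal_of_var_ne_zero _ hv, gaussianReal_of_var_ne_zero _ hv,
    ← withDensity_mul _ (measurable_gaussianPDF b v)
      (measurable_likelihoodRatio a b v)]
  congr 1
  funext x
  exact (ENNReal.mul_div_cancel (gaussianPDF_pos b hv x).ne' gaussianPDF_ne_top).symm

/-- Completing the square: the squared likelihood ratio, weighted by the density at `b`, is again
Gaussian, centred at the reflection of `b` through `a`. -/
theorem gaussianPDFReal_sq (a b : ℝ) {v : ℝ≥0} (hv : v ≠ 0) (x : ℝ) :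
    gaussianPDFReal a v x ^ 2 = gaussianPDFReal b v x
      * (Real.exp ((a - b) ^ 2 / v) * gaussianPDFReal (2 * a - b) v x) := by
  have hv' : (v : ℝ) ≠ 0 := by exact_mod_cast hv
  simp only [gaussianPDFReal]
  rw [mul_pow, ← Real.exp_nat_mul]
  calc _ = (√(2 * Real.pi * v))⁻¹ ^ 2 * Real.exp (-(x - b) ^ 2 / (2 * v) + (a - b) ^ 2 / v
        + -(x - (2 * a - b)) ^ 2 / (2 * v)) := by
          congr 2
          field_simp
          push_cast
          ring
    _ = _ := by
          rw [Real.exp_add, Real.exp_add]; ring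

theorem lintegral_gaussian_likelihoodRatio_sq (a b : ℝ) {v : ℝ≥0} (hv : v ≠ 0) :
    ∫⁻ x, (gaussianPDF a v x / gaussianPDF b v x) ^ 2 ∂(gaussianReal b v)
      = ENNReal.ofReal (Real.exp ((a - b) ^ 2 / v)) := by
  rw [gaussianReal_of_var_ne_zero _ hv, lintegral_withDensity_eq_lintegral_mul _
    (measurable_gaussianPDF b v)
    ((measurable_likelihoodRatio a b v).pow_const 2)]
  have e : ∀ x, (gaussianPDF b v * fun x => (gaussianPDF a v x / gaussianPDF b v x) ^ 2) x
      = ENNReal.ofReal (Real.exp ((a - b) ^ 2 / v)) * gaussianPDF (2 * a - b) v x := by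
    intro x
    have hb := gaussianPDFReal_pos b v x hv
    simp only [Pi.mul_apply, gaussianPDF]
    rw [← ENNReal.ofReal_div_of_pos hb, ← ENNReal.ofReal_pow (by
      have := gaussianPDFReal_nonneg a v x; positivity), ← ENNReal.ofReal_mul hb.le,
      ← ENNReal.ofReal_mul (Real.exp_pos _).le, div_pow, gaussianPDFReal_sq a b hv x]
    congr 1
    field_simp
  simp_rw [e]
  rw [lintegral_const_mul _ (measurable_gaussianPDF _ v), lintegral_gaussianPDF_eq_one _ hv,
    mul_one]

end GaussianShift

/-! ### Parseval, mutual absolute continuity of the observation laws, and coefficients of the random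
series. -/

theorem hasSum_coeff_sub_sq (ψ : WaveletBasis) (f g : L2I) :
    HasSum (fun i => (coeff ψ f i - coeff ψ g i) ^ 2) (‖f - g‖ ^ 2) := by
  have := ψ.hasSum_inner_mul_inner (f - g) (f - g)
  rw [real_inner_self_eq_norm_sq] at this
  convert! this using 2 with i
  rw [real_inner_comm (ψ i) (f - g), ← pow_two, inner_sub_right]
  rfl

theorem ofReal_norm_sub_sq (ψ : WaveletBasis) (f g : L2I) :
    ENNReal.ofReal (‖f - g‖ ^ 2)
      = ∑' i, ENNReal.ofReal ((coeff ψ f i - coeff ψ g i) ^ 2) := by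
  have h := hasSum_coeff_sub_sq ψ f g
  rw [← h.tsum_eq, ENNReal.ofReal_tsum_of_nonneg (fun i => sq_nonneg _) h.summable]

theorem measurable_coeff (ψ : WaveletBasis) (i : WaveletIndex) :
    Measurable fun f : L2I => coeff ψ f i := by
  unfold coeff
  exact (continuous_const.inner continuous_id).measurable

theorem obsLaw_absolutelyContinuous (ψ : WaveletBasis) {n : ℕ} (hn : n ≠ 0) (f g : L2I) :
    obsLaw ψ n f ≪ obsLaw ψ n g := by
  have hv : (n : ℝ≥0)⁻¹ ≠ 0 := by simpa using hn
  refine infinitePi_absolutelyContinuous _ _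
    (z := fun i x => gaussianPDF (coeff ψ f i) (n : ℝ≥0)⁻¹ x
      / gaussianPDF (coeff ψ g i) (n : ℝ≥0)⁻¹ x)
    (C := (Real.exp (n * ‖f - g‖ ^ 2)).toNNReal)
    (fun i => measurable_likelihoodRatio _ _ _)
    (fun i => gaussianReal_eq_withDensity_shift _ _ hv) fun F => ?_
  simp_rw [lintegral_gaussian_likelihoodRatio_sq _ _ hv]
  rw [← ENNReal.ofReal_prod_of_nonneg fun _ _ => (Real.exp_pos _).le, ← Real.exp_sum,
    ← Finset.sum_div]
  refine ENNReal.ofReal_le_ofReal (Real.exp_le_exp.2 ?_)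
  have h := hasSum_coeff_sub_sq ψ f g
  have h2 := sum_le_hasSum F (fun i _ => sq_nonneg _) h
  push_cast
  rw [div_inv_eq_mul, mul_comm]
  gcongr

/-- The posterior is determined only up to null sets of the marginal, so this is what lets its
formulas be used under a fixed truth. A marginal-null set is null under `obsLaw ψ n g` for some `g`,
hence under every `f`. -/
theorem obsLaw_absolutelyContinuous_comp (ψ : WaveletBasis) {n : ℕ} (hn : n ≠ 0) (f : L2I)
    (μ : Measure L2I) [IsProbabilityMeasure μ] :
    obsLaw ψ n f ≪ whiteNoise ψ n ∘ₘ μ := by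
  refine Measure.AbsolutelyContinuous.mk fun s hs h0 => ?_
  rw [Measure.bind_apply hs (Kernel.aemeasurable _),
    lintegral_eq_zero_iff ((whiteNoise ψ n).measurable_coe hs)] at h0
  obtain ⟨g, hg⟩ := h0.exists
  exact obsLaw_absolutelyContinuous ψ hn f g hg

/-- The expected squared norm is finite, so the random coefficients are almost surely square
summable and the series converges; otherwise `tsum` could take its default value 0. -/
theorem ae_coeff_series_eq (ψ : WaveletBasis) {s : ℕ → ℝ}
    (hs : Summable fun i : WaveletIndex => s i.1 ^ 2) (H : Measure ℝ) [IsProbabilityMeasure H]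
    (hH : ∫⁻ z, ENNReal.ofReal (z ^ 2) ∂H ≠ ∞) :
    ∀ᵐ ζ ∂(Measure.infinitePi fun _ : WaveletIndex => H), ∀ i,
      coeff ψ (∑' i : WaveletIndex, (s i.1 * ζ i) • ψ i) i = s i.1 * ζ i := by
  have hm : Measurable fun z : ℝ => ENNReal.ofReal (z ^ 2) := by fun_prop
  have hm' : ∀ i : WaveletIndex, Measurable fun ζ : WaveletIndex → ℝ =>
      ENNReal.ofReal ((s i.1 * ζ i) ^ 2) := fun i =>
    (hm.comp (measurable_const_mul (s i.1))).comp (measurable_pi_apply i)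
  have hint : ∫⁻ ζ, ∑' i : WaveletIndex, ENNReal.ofReal ((s i.1 * ζ i) ^ 2)
      ∂(Measure.infinitePi fun _ : WaveletIndex => H) ≠ ∞ := by
    rw [lintegral_tsum fun i => (hm' i).aemeasurable]
    have e : ∀ i : WaveletIndex, ∫⁻ ζ, ENNReal.ofReal ((s i.1 * ζ i) ^ 2)
        ∂(Measure.infinitePi fun _ : WaveletIndex => H)
        = ENNReal.ofReal (s i.1 ^ 2) * ∫⁻ z, ENNReal.ofReal (z ^ 2) ∂H := by
      intro i
      simp_rw [mul_pow, ENNReal.ofReal_mul (sq_nonneg (s i.1))]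
      rw [lintegral_const_mul _ (by fun_prop)]
      conv_rhs => rw [← Measure.infinitePi_map_eval (fun _ : WaveletIndex => H) i,
        lintegral_map hm (measurable_pi_apply i)]
    simp_rw [e]
    rw [ENNReal.tsum_mul_right, ← ENNReal.ofReal_tsum_of_nonneg (fun i => sq_nonneg _) hs]
    exact ENNReal.mul_ne_top ENNReal.ofReal_ne_top hH
  filter_upwards [ae_lt_top (Measurable.tsum hm') hint] with ζ hζ
  have hsum : Summable fun i : WaveletIndex => (s i.1 * ζ i) ^ 2 := by
    have := ENNReal.summable_toReal hζ.ne
    simpa [ENNReal.toReal_ofReal (sq_nonneg _)] using this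
  have hmem : Memℓp (fun i : WaveletIndex => s i.1 * ζ i) 2 := by
    rw [memℓp_gen_iff (by norm_num)]
    simpa [← mul_pow, ← abs_mul] using hsum
  let c : lp (fun _ : WaveletIndex => ℝ) 2 := ⟨_, hmem⟩
  intro i
  have h1 := (ψ.hasSum_repr_symm c).tsum_eq
  have h2 : ∑' i : WaveletIndex, (s i.1 * ζ i) • ψ i = ψ.repr.symm c := h1
  rw [h2, coeff, ← ψ.repr_apply_apply, LinearIsometryEquiv.apply_symm_apply]

/-- Bayes' rule in integrated form: both sides integrate over the same joint law, disintegrated in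
the two orders. -/
theorem setLIntegral_posterior {Ω 𝓧 : Type*} {mΩ : MeasurableSpace Ω} {m𝓧 : MeasurableSpace 𝓧}
    [StandardBorelSpace Ω] [Nonempty Ω] (κ : Kernel Ω 𝓧) [IsFiniteKernel κ] (μ : Measure Ω)
    [IsFiniteMeasure μ] {g : Ω → ℝ≥0∞} (hg : Measurable g) {B : Set 𝓧} (hB : MeasurableSet B) :
    ∫⁻ x in B, ∫⁻ ω, g ω ∂(posterior κ μ x) ∂(κ ∘ₘ μ) = ∫⁻ ω, g ω * κ ω B ∂μ := by
  have h := Measure.setLIntegral_compProd (μ := κ ∘ₘ μ) (κ := posterior κ μ)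
    (f := fun p => g p.2) (hg.comp measurable_snd) hB MeasurableSet.univ
  simp only [Measure.restrict_univ] at h
  rw [← h, compProd_posterior_eq_map_swap,
    setLIntegral_map (f := fun p : 𝓧 × Ω => g p.2) (hB.prod .univ) (hg.comp measurable_snd)
      measurable_swap,
    show Prod.swap ⁻¹' (B ×ˢ (Set.univ : Set Ω)) = (Set.univ : Set Ω) ×ˢ B by ext; simp,
    Measure.setLIntegral_compProd (by fun_prop) .univ hB]
  simp

/-! ### One-dimensional Bayes formula and factorization of the posterior over coordinates. -/

/-- The marginal density at `y` of an observation `N(s z, v)` with `z ∼ H`. -/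
noncomputable def evidence (H : Measure ℝ) (s : ℝ) (v : ℝ≥0) (y : ℝ) : ℝ≥0∞ :=
  ∫⁻ z, gaussianPDF (s * z) v y ∂H

/-- The posterior mean of `g (s z)` when `z ∼ H` and `y ∼ N(s z, v)` is observed. -/
noncomputable def coordPosterior (H : Measure ℝ) (s : ℝ) (v : ℝ≥0) (g : ℝ → ℝ≥0∞) (y : ℝ) :
    ℝ≥0∞ :=
  (∫⁻ z, g (s * z) * gaussianPDF (s * z) v y ∂H) / evidence H s v y

section Coord

variable (H : Measure ℝ) [IsProbabilityMeasure H] (s : ℝ) {v : ℝ≥0}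

theorem measurable_gaussianPDF_mul (s : ℝ) (v : ℝ≥0) :
    Measurable fun p : ℝ × ℝ => gaussianPDF (s * p.2) v p.1 :=
  measurable_uncurry_gaussianPDF.comp
    (f := fun p : ℝ × ℝ => (s * p.2, v, p.1)) (by fun_prop)

theorem measurable_gaussianPDF_mul_left (s : ℝ) (v : ℝ≥0) (y : ℝ) :
    Measurable fun z => gaussianPDF (s * z) v y :=
  measurable_uncurry_gaussianPDF.comp (f := fun z : ℝ => (s * z, v, y)) (by fun_prop)

theorem measurable_evidence : Measurable (evidence H s v) :=
  (measurable_gaussianPDF_mul s v).lintegral_prod_right'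

theorem measurable_coordPosterior_num {g : ℝ → ℝ≥0∞} (hg : Measurable g) :
    Measurable fun y => ∫⁻ z, g (s * z) * gaussianPDF (s * z) v y ∂H :=
  Measurable.lintegral_prod_right' (f := fun p : ℝ × ℝ => g (s * p.2) * gaussianPDF (s * p.2) v p.1)
    (Measurable.mul (by fun_prop) (measurable_gaussianPDF_mul s v))

theorem measurable_coordPosterior {g : ℝ → ℝ≥0∞} (hg : Measurable g) :
    Measurable (coordPosterior H s v g) :=
  (measurable_coordPosterior_num H s hg).div (measurable_evidence H s)

theorem evidence_ne_zero (hv : v ≠ 0) (y : ℝ) : evidence H s v y ≠ 0 := by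
  intro h0
  rw [evidence, lintegral_eq_zero_iff (measurable_gaussianPDF_mul_left s v y)] at h0
  obtain ⟨z, hz⟩ := h0.exists
  exact (gaussianPDF_pos (s * z) hv y).ne' hz

theorem evidence_ne_top (y : ℝ) : evidence H s v y ≠ ∞ := by
  refine ne_top_of_le_ne_top (ENNReal.ofReal_ne_top (r := (√(2 * Real.pi * v))⁻¹)) ?_
  calc evidence H s v y ≤ ∫⁻ _, ENNReal.ofReal (√(2 * Real.pi * v))⁻¹ ∂H := by
        refine lintegral_mono fun z => ENNReal.ofReal_le_ofReal ?_
        rw [gaussianPDFReal]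
        refine mul_le_of_le_one_right (by positivity) (Real.exp_le_one_iff.2 ?_)
        exact div_nonpos_of_nonpos_of_nonneg (by nlinarith [sq_nonneg (y - s * z)]) (by positivity)
    _ = _ := by simp

theorem coordPosterior_one (hv : v ≠ 0) (y : ℝ) : coordPosterior H s v (fun _ => 1) y = 1 := by
  simp only [coordPosterior, one_mul]
  exact ENNReal.div_self (evidence_ne_zero H s hv y) (evidence_ne_top H s y)

theorem setLIntegral_coordPosterior (hv : v ≠ 0) {g : ℝ → ℝ≥0∞} (hg : Measurable g) {t : Set ℝ}
    (ht : MeasurableSet t) :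
    ∫⁻ y in t, coordPosterior H s v g y ∂(volume.withDensity (evidence H s v))
      = ∫⁻ z, g (s * z) * gaussianReal (s * z) v t ∂H := by
  rw [setLIntegral_withDensity_eq_setLIntegral_mul _ (measurable_evidence H s)
    (measurable_coordPosterior H s hg) ht]
  have e : ∀ y, (evidence H s v * coordPosterior H s v g) y
      = ∫⁻ z, g (s * z) * gaussianPDF (s * z) v y ∂H := fun y =>
    ENNReal.mul_div_cancel (evidence_ne_zero H s hv y) (evidence_ne_top H s y)
  simp_rw [e]
  rw [lintegral_lintegral_swap (((by fun_prop : Measurable fun p : ℝ × ℝ => g (s * p.2)).mul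
    (measurable_gaussianPDF_mul s v)).aemeasurable)]
  refine lintegral_congr fun z => ?_
  rw [lintegral_const_mul _ (measurable_gaussianPDF _ _), gaussianReal_apply _ hv]

theorem isProbabilityMeasure_evidence (hv : v ≠ 0) :
    IsProbabilityMeasure (volume.withDensity (evidence H s v)) := by
  constructor
  have := setLIntegral_coordPosterior H s hv (g := fun _ => 1) measurable_const MeasurableSet.univ
  simpa [coordPosterior_one H s hv] using this

end Coord

section Factorization

variable (ψ : WaveletBasis) {s : ℕ → ℝ} (hs : Summable fun i : WaveletIndex => s i.1 ^ 2)
  (H : Measure ℝ) [IsProbabilityMeasure H] (hH : ∫⁻ z, ENNReal.ofReal (z ^ 2) ∂H ≠ ∞)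
  {n : ℕ} (hn : n ≠ 0)

include hs hH hn

/-- After Bayes' rule the integrand is a product over the independent prior variables, so the
integral splits. With constant test functions it identifies the marginal; with one nonconstant test
function it identifies the posterior of a coordinate. -/
theorem setLIntegral_box_posterior_prod (S : Finset WaveletIndex)
    {t : WaveletIndex → Set ℝ} (ht : ∀ i, MeasurableSet (t i)) {g : WaveletIndex → ℝ → ℝ≥0∞}
    (hg : ∀ i, Measurable (g i)) :
    ∫⁻ x in (S : Set WaveletIndex).pi t, ∫⁻ f, ∏ i ∈ S, g i (coeff ψ f i)
        ∂(posterior (whiteNoise ψ n) (seriesPrior ψ s H) x) ∂(whiteNoise ψ n ∘ₘ seriesPrior ψ s H)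
      = ∏ i ∈ S, ∫⁻ y in t i, coordPosterior H (s i.1) (n : ℝ≥0)⁻¹ (g i) y
          ∂(volume.withDensity (evidence H (s i.1) (n : ℝ≥0)⁻¹)) := by
  have hv : (n : ℝ≥0)⁻¹ ≠ 0 := by simpa using hn
  have hG : Measurable fun f : L2I => ∏ i ∈ S, g i (coeff ψ f i) :=
    Finset.measurable_prod _ fun i _ => (hg i).comp (measurable_coeff ψ i)
  have hbox : MeasurableSet ((S : Set WaveletIndex).pi t) :=
    MeasurableSet.pi S.countable_toSet fun i _ => ht i
  have hGk : Measurable fun f : L2I => (∏ i ∈ S, g i (coeff ψ f i))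
      * whiteNoise ψ n f ((S : Set WaveletIndex).pi t) :=
    hG.mul ((whiteNoise ψ n).measurable_coe hbox)
  rw [setLIntegral_posterior _ _ hG hbox, seriesPrior, lintegral_map hGk (measurable_series ψ s)]
  have hk : ∀ i : WaveletIndex, Measurable fun z : ℝ =>
      g i (s i.1 * z) * gaussianReal (s i.1 * z) (n : ℝ≥0)⁻¹ (t i) := fun i => by
    refine Measurable.mul (by fun_prop) ?_
    exact (Measure.measurable_coe (ht i)).comp (measurable_gaussianReal.comp
      (f := fun z : ℝ => (s i.1 * z, (n : ℝ≥0)⁻¹)) (by fun_prop))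
  have e : ∀ᵐ ζ ∂(Measure.infinitePi fun _ : WaveletIndex => H),
      (∏ i ∈ S, g i (coeff ψ (∑' i : WaveletIndex, (s i.1 * ζ i) • ψ i) i))
        * whiteNoise ψ n (∑' i : WaveletIndex, (s i.1 * ζ i) • ψ i) ((S : Set WaveletIndex).pi t)
      = ∏ i ∈ S, g i (s i.1 * ζ i) * gaussianReal (s i.1 * ζ i) (n : ℝ≥0)⁻¹ (t i) := by
    filter_upwards [ae_coeff_series_eq ψ hs H hH] with ζ hζ
    change _ * obsLaw ψ n _ _ = _
    rw [obsLaw, Measure.infinitePi_pi _ fun i _ => ht i, Finset.prod_mul_distrib]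
    simp_rw [hζ]
  rw [lintegral_congr_ae e, lintegral_infinitePi_prod (fun _ : WaveletIndex => H) S hk]
  exact Finset.prod_congr rfl fun i _ => (setLIntegral_coordPosterior H _ hv (hg i) (ht i)).symm

theorem marginal_eq_infinitePi :
    haveI := fun i : WaveletIndex => isProbabilityMeasure_evidence H (s i.1)
      (v := (n : ℝ≥0)⁻¹) (by simpa using hn)
    whiteNoise ψ n ∘ₘ seriesPrior ψ s H = Measure.infinitePi fun i : WaveletIndex =>
      volume.withDensity (evidence H (s i.1) (n : ℝ≥0)⁻¹) := by
  have hv : (n : ℝ≥0)⁻¹ ≠ 0 := by simpa using hn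
  have := fun i : WaveletIndex => isProbabilityMeasure_evidence H (s i.1) hv
  refine Measure.eq_infinitePi _ fun S t ht => ?_
  have := setLIntegral_box_posterior_prod ψ hs H hH hn S ht (g := fun _ _ => 1)
    fun _ => measurable_const
  simpa [coordPosterior_one H _ hv] using this

theorem ae_lintegral_posterior_coeff_eq (i : WaveletIndex) {g : ℝ → ℝ≥0∞} (hg : Measurable g)
    (hfin : ∫⁻ z, g (s i.1 * z) ∂H ≠ ∞) :
    ∀ᵐ x ∂(whiteNoise ψ n ∘ₘ seriesPrior ψ s H),
      ∫⁻ f, g (coeff ψ f i) ∂(posterior (whiteNoise ψ n) (seriesPrior ψ s H) x)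
        = coordPosterior H (s i.1) (n : ℝ≥0)⁻¹ g (x i) := by
  classical
  have hv : (n : ℝ≥0)⁻¹ ≠ 0 := by simpa using hn
  have := fun i : WaveletIndex => isProbabilityMeasure_evidence H (s i.1) hv
  set M := whiteNoise ψ n ∘ₘ seriesPrior ψ s H with hM
  have hgi : Measurable fun f : L2I => g (coeff ψ f i) := hg.comp (measurable_coeff ψ i)
  have hL : Measurable fun x =>
      ∫⁻ f, g (coeff ψ f i) ∂(posterior (whiteNoise ψ n) (seriesPrior ψ s H) x) :=
    hgi.lintegral_kernel
  have hR : Measurable fun x : WaveletIndex → ℝ =>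
      coordPosterior H (s i.1) (n : ℝ≥0)⁻¹ g (x i) :=
    (measurable_coordPosterior H _ hg).comp (measurable_pi_apply i)
  -- Testing with `g` at `i` and 1 elsewhere isolates a single coordinate in the product formula.
  let G : WaveletIndex → ℝ → ℝ≥0∞ := fun j => if j = i then g else fun _ => 1
  have hG : ∀ j, Measurable (G j) := fun j => by
    by_cases h : j = i <;> simp [G, h, hg]
  have hcoord : ∀ j y, coordPosterior H (s j.1) (n : ℝ≥0)⁻¹ (G j) y
      = if j = i then coordPosterior H (s i.1) (n : ℝ≥0)⁻¹ g y else 1 := by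
    intro j y
    by_cases h : j = i
    · subst h; simp [G]
    · simp [G, h, coordPosterior_one H _ hv]
  have hprod : ∀ {S : Finset WaveletIndex}, i ∈ S → ∀ c : WaveletIndex → ℝ,
      ∏ j ∈ S, G j (c j) = g (c i) := by
    intro S hi c
    rw [Finset.prod_eq_single_of_mem i hi fun j _ hj => by simp [G, hj]]
    simp [G]
  have hbox : ∀ S : Finset WaveletIndex, i ∈ S → ∀ t : WaveletIndex → Set ℝ,
      (∀ j, MeasurableSet (t j)) →
      ∫⁻ x in (S : Set WaveletIndex).pi t,
        ∫⁻ f, g (coeff ψ f i) ∂(posterior (whiteNoise ψ n) (seriesPrior ψ s H) x) ∂M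
      = ∫⁻ x in (S : Set WaveletIndex).pi t, coordPosterior H (s i.1) (n : ℝ≥0)⁻¹ g (x i) ∂M := by
    intro S hi t ht
    have h1 := setLIntegral_box_posterior_prod ψ hs H hH hn S ht hG
    have e1 : ∀ f : L2I, ∏ j ∈ S, G j (coeff ψ f j) = g (coeff ψ f i) := fun f => hprod hi _
    simp_rw [e1] at h1
    have hb : MeasurableSet ((S : Set WaveletIndex).pi t) :=
      MeasurableSet.pi S.countable_toSet fun i _ => ht i
    rw [h1, ← lintegral_indicator hb, hM, marginal_eq_infinitePi ψ hs H hH hn]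
    have e2 : ∀ x : WaveletIndex → ℝ, ((S : Set WaveletIndex).pi t).indicator
        (fun x => coordPosterior H (s i.1) (n : ℝ≥0)⁻¹ g (x i)) x
        = ∏ j ∈ S, (t j).indicator (coordPosterior H (s j.1) (n : ℝ≥0)⁻¹ (G j)) (x j) := by
      intro x
      by_cases hx : x ∈ (S : Set WaveletIndex).pi t
      · rw [Set.indicator_of_mem hx, Finset.prod_eq_single_of_mem i hi]
        · rw [Set.indicator_of_mem (hx i hi), hcoord, if_pos rfl]
        · intro j hj hji
          rw [Set.indicator_of_mem (hx j hj), hcoord, if_neg hji]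
      · rw [Set.indicator_of_notMem hx]
        have : ∃ j ∈ S, x j ∉ t j := by
          by_contra! hc
          exact hx fun j hj => hc j hj
        obtain ⟨j, hj, hjt⟩ := this
        exact (Finset.prod_eq_zero hj (Set.indicator_of_notMem hjt _)).symm
    simp_rw [e2]
    rw [lintegral_infinitePi_prod _ S fun j =>
      (measurable_coordPosterior H _ (hG j)).indicator (ht j)]
    exact Finset.prod_congr rfl fun j _ => (lintegral_indicator (ht j) _).symm
  have hfinL : ∫⁻ x, ∫⁻ f, g (coeff ψ f i)
      ∂(posterior (whiteNoise ψ n) (seriesPrior ψ s H) x) ∂M ≠ ∞ := by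
    have h1 := setLIntegral_posterior (whiteNoise ψ n) (seriesPrior ψ s H) hgi MeasurableSet.univ
    simp only [Measure.restrict_univ, measure_univ, mul_one] at h1
    rw [h1, seriesPrior, lintegral_map hgi (measurable_series ψ s)]
    rw [lintegral_congr_ae (g := fun ζ => g (s i.1 * ζ i))
      (by filter_upwards [ae_coeff_series_eq ψ hs H hH] with ζ hζ; rw [hζ])]
    rw [← Measure.infinitePi_map_eval (fun _ : WaveletIndex => H) i,
      lintegral_map (by fun_prop) (measurable_pi_apply i)] at hfin
    exact hfin
  have : IsFiniteMeasure (M.withDensity fun x =>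
      ∫⁻ f, g (coeff ψ f i) ∂(posterior (whiteNoise ψ n) (seriesPrior ψ s H) x)) :=
    isFiniteMeasure_withDensity hfinL
  refine (withDensity_eq_iff hL.aemeasurable hR.aemeasurable hfinL).1 ?_
  have hkey : ∀ A ∈ squareCylinders fun _ : WaveletIndex => {t : Set ℝ | MeasurableSet t},
      (M.withDensity fun x =>
        ∫⁻ f, g (coeff ψ f i) ∂(posterior (whiteNoise ψ n) (seriesPrior ψ s H) x)) A
      = (M.withDensity fun x => coordPosterior H (s i.1) (n : ℝ≥0)⁻¹ g (x i)) A := by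
    rintro _ ⟨S, t, ht, rfl⟩
    have ht' : ∀ j, MeasurableSet (t j) := fun j => ht j (Set.mem_univ j)
    have hb : MeasurableSet ((S : Set WaveletIndex).pi t) :=
      MeasurableSet.pi S.countable_toSet fun i _ => ht' i
    rw [withDensity_apply _ hb, withDensity_apply _ hb]
    -- The product formula needs `i` among the constrained indices; when it is missing, it is added
    -- with the trivial constraint.
    have e : (S : Set WaveletIndex).pi t
        = ((insert i S : Finset WaveletIndex) : Set WaveletIndex).pi
          (fun j => if j ∈ S then t j else Set.univ) := by
      ext x
      simp only [Set.mem_pi, Finset.mem_coe, Finset.mem_insert]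
      constructor
      · intro h j _
        by_cases hj : j ∈ S
        · simp only [hj, if_true]; exact h j hj
        · simp [hj]
      · intro h j hj
        simpa [hj] using h j (.inr hj)
    rw [e]
    refine hbox _ (Finset.mem_insert_self _ _) _ fun j => ?_
    by_cases hj : j ∈ S <;> simp [hj, ht']
  refine ext_of_generate_finite _ generateFrom_squareCylinders.symm
    (isPiSystem_squareCylinders (fun _ => MeasurableSpace.isPiSystem_measurableSet)
      fun _ => by simp) hkey (hkey _ ⟨∅, fun _ => Set.univ, by simp, by simp⟩)

end Factorization

/-! ### Reduction to truncated coordinate risks, and the Gaussian tail bound. -/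

theorem expectedPosteriorMass_le (ψ : WaveletBasis) {s : ℕ → ℝ}
    (hs : Summable fun i : WaveletIndex => s i.1 ^ 2) (H : Measure ℝ) [IsProbabilityMeasure H]
    (hH : ∫⁻ z, ENNReal.ofReal (z ^ 2) ∂H ≠ ∞) {n : ℕ} (hn : n ≠ 0) (f₀ : L2I) {ε : ℝ}
    (hε : 0 < ε) (t : WaveletIndex → ℝ) :
    expectedPosteriorMass ψ s H n f₀ ε
      ≤ (∑' i, gaussianReal (coeff ψ f₀ i) (n : ℝ≥0)⁻¹ {y | t i < |y - coeff ψ f₀ i|})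
        + (ENNReal.ofReal (ε ^ 2))⁻¹ * ∑' i, ∫⁻ y in {y | |y - coeff ψ f₀ i| ≤ t i},
          coordPosterior H (s i.1) (n : ℝ≥0)⁻¹
            (fun θ => ENNReal.ofReal ((θ - coeff ψ f₀ i) ^ 2)) y
          ∂(gaussianReal (coeff ψ f₀ i) (n : ℝ≥0)⁻¹) := by
  set P := obsLaw ψ n f₀ with hP
  set post := posterior (whiteNoise ψ n) (seriesPrior ψ s H) with hpost
  set a := coeff ψ f₀ with ha
  set R : WaveletIndex → ℝ → ℝ≥0∞ := fun i => coordPosterior H (s i.1) (n : ℝ≥0)⁻¹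
    (fun θ => ENNReal.ofReal ((θ - a i) ^ 2)) with hR
  have hgm : ∀ i, Measurable fun θ : ℝ => ENNReal.ofReal ((θ - a i) ^ 2) := fun i => by fun_prop
  have hRm : ∀ i, Measurable (R i) := fun i => measurable_coordPosterior H _ (hgm i)
  have hball : ∀ i, MeasurableSet {y : ℝ | |y - a i| ≤ t i} := fun i =>
    measurableSet_le (by fun_prop) measurable_const
  have hout : ∀ i, MeasurableSet {y : ℝ | t i < |y - a i|} := fun i =>
    measurableSet_lt measurable_const (by fun_prop)
  have hPi : ∀ i, P.map (fun x => x i) = gaussianReal (a i) (n : ℝ≥0)⁻¹ := fun i =>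
    Measure.infinitePi_map_eval _ i
  have hfin : ∀ i : WaveletIndex,
      ∫⁻ z, ENNReal.ofReal ((s i.1 * z - a i) ^ 2) ∂H ≠ ∞ := by
    intro i
    refine ne_top_of_le_ne_top (b := ∫⁻ z, (ENNReal.ofReal (2 * s i.1 ^ 2) * ENNReal.ofReal (z ^ 2)
      + ENNReal.ofReal (2 * a i ^ 2)) ∂H) ?_ (lintegral_mono fun z => ?_)
    · rw [lintegral_add_right _ measurable_const, lintegral_const_mul _ (by fun_prop)]
      exact ENNReal.add_ne_top.2 ⟨ENNReal.mul_ne_top ENNReal.ofReal_ne_top hH, by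
        rw [lintegral_const, measure_univ, mul_one]; exact ENNReal.ofReal_ne_top⟩
    · rw [← ENNReal.ofReal_mul (by positivity), ← ENNReal.ofReal_add (by positivity)
        (by positivity)]
      exact ENNReal.ofReal_le_ofReal (by nlinarith [sq_nonneg (s i.1 * z + a i)])
  have hpostR : ∀ᵐ x ∂P, ∀ i,
      ∫⁻ f, ENNReal.ofReal ((coeff ψ f i - a i) ^ 2) ∂(post x) = R i (x i) := by
    have h : ∀ i, ∀ᵐ x ∂P,
        ∫⁻ f, ENNReal.ofReal ((coeff ψ f i - a i) ^ 2) ∂(post x) = R i (x i) := fun i =>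
      (obsLaw_absolutelyContinuous_comp ψ hn f₀ (seriesPrior ψ s H)).ae_le
        (ae_lintegral_posterior_coeff_eq ψ hs H hH hn i
          (g := fun θ => ENNReal.ofReal ((θ - a i) ^ 2)) (hgm i) (hfin i))
    exact ae_all_iff.2 h
  have hε2 : ENNReal.ofReal (ε ^ 2) ≠ 0 := by simpa using hε.ne'
  have hmass : ∀ᵐ x ∂P, post x {f | ‖f - f₀‖ > ε}
      ≤ (ENNReal.ofReal (ε ^ 2))⁻¹ * ∑' i, R i (x i) := by
    filter_upwards [hpostR] with x hx
    have hN : Measurable fun f : L2I => ENNReal.ofReal (‖f - f₀‖ ^ 2) := by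
      have : Continuous fun f : L2I => ‖f - f₀‖ ^ 2 := by fun_prop
      exact this.measurable.ennreal_ofReal
    calc post x {f | ‖f - f₀‖ > ε}
        ≤ post x {f | ENNReal.ofReal (ε ^ 2) ≤ ENNReal.ofReal (‖f - f₀‖ ^ 2)} := by
          refine measure_mono fun f hf => ENNReal.ofReal_le_ofReal ?_
          have : ε < ‖f - f₀‖ := hf
          gcongr
      _ ≤ (∫⁻ f, ENNReal.ofReal (‖f - f₀‖ ^ 2) ∂(post x)) / ENNReal.ofReal (ε ^ 2) :=
          meas_ge_le_lintegral_div hN.aemeasurable hε2 ENNReal.ofReal_ne_top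
      _ = (ENNReal.ofReal (ε ^ 2))⁻¹ * ∑' i, R i (x i) := by
          simp_rw [ofReal_norm_sub_sq ψ]
          have hc : ∀ i, Measurable fun f : L2I => ENNReal.ofReal ((coeff ψ f i - a i) ^ 2) :=
            fun i => (hgm i).comp (measurable_coeff ψ i)
          rw [lintegral_tsum fun i => (hc i).aemeasurable, ENNReal.div_eq_inv_mul]
          congr 1
          exact tsum_congr hx
  -- Off `E` the posterior mass is bounded by 1 and a union bound gives the tail sum. On `E`
  -- Markov's inequality applies, and each risk is then integrated over its own constraint only.
  set E : Set (WaveletIndex → ℝ) := {x | ∀ i, |x i - a i| ≤ t i} with hE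
  have hEm : MeasurableSet E := by
    have : E = ⋂ i, (fun x : WaveletIndex → ℝ => x i) ⁻¹' {y | |y - a i| ≤ t i} := by
      ext x; simp [hE]
    rw [this]
    exact MeasurableSet.iInter fun i => measurable_pi_apply i (hball i)
  rw [expectedPosteriorMass, ← lintegral_add_compl _ hEm, add_comm]
  refine add_le_add ?_ ?_
  · calc ∫⁻ x in Eᶜ, post x {f | ‖f - f₀‖ > ε} ∂P ≤ ∫⁻ _ in Eᶜ, 1 ∂P :=
          lintegral_mono fun x => prob_le_one
      _ = P Eᶜ := by simp
      _ ≤ P (⋃ i, (fun x : WaveletIndex → ℝ => x i) ⁻¹' {y | t i < |y - a i|}) := by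
          refine measure_mono fun x hx => ?_
          simpa [hE] using hx
      _ ≤ ∑' i, P ((fun x : WaveletIndex → ℝ => x i) ⁻¹' {y | t i < |y - a i|}) :=
          measure_iUnion_le _
      _ = _ := by
          refine tsum_congr fun i => ?_
          rw [← hPi i, Measure.map_apply (measurable_pi_apply i) (hout i)]
  · calc ∫⁻ x in E, post x {f | ‖f - f₀‖ > ε} ∂P
        ≤ ∫⁻ x in E, (ENNReal.ofReal (ε ^ 2))⁻¹ * ∑' i, R i (x i) ∂P :=
          lintegral_mono_ae (ae_restrict_of_ae hmass)
      _ = (ENNReal.ofReal (ε ^ 2))⁻¹ * ∑' i, ∫⁻ x in E, R i (x i) ∂P := by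
          have hRx : ∀ i, Measurable fun x : WaveletIndex → ℝ => R i (x i) := fun i =>
            (hRm i).comp (measurable_pi_apply i)
          rw [lintegral_const_mul _ (Measurable.tsum hRx),
            lintegral_tsum fun i => (hRx i).aemeasurable]
      _ ≤ _ := by
          gcongr with i
          calc ∫⁻ x in E, R i (x i) ∂P
              ≤ ∫⁻ x in (fun x : WaveletIndex → ℝ => x i) ⁻¹' {y | |y - a i| ≤ t i},
                R i (x i) ∂P := lintegral_mono_set fun x hx => hx i
            _ = _ := by
                rw [← hPi i, setLIntegral_map (hball i) (hRm i) (measurable_pi_apply i)]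

/-- Chernoff's bound with the fixed parameter √n. The exponent is only linear in `t`, which costs
nothing but logarithms. -/
theorem gaussianReal_tail_le (a : ℝ) {n : ℕ} (hn : n ≠ 0) (t : ℝ) :
    gaussianReal a (n : ℝ≥0)⁻¹ {y | t / √n < |y - a|}
      ≤ ENNReal.ofReal (2 * Real.exp (1 / 2 - t)) := by
  have hn' : (0 : ℝ) < n := by positivity
  have hsq : √(n : ℝ) ^ 2 = n := Real.sq_sqrt hn'.le
  have hs0 : 0 < √(n : ℝ) := Real.sqrt_pos.2 hn'
  set μ := gaussianReal a (n : ℝ≥0)⁻¹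
  have hmgf : ∀ c : ℝ, mgf (fun x : ℝ => x) μ c = Real.exp (a * c + (n : ℝ)⁻¹ * c ^ 2 / 2) := by
    intro c
    rw [mgf_fun_id_gaussianReal]
    simp
  have h1 : μ.real {y | a + t / √n ≤ y} ≤ Real.exp (1 / 2 - t) := by
    refine (measure_ge_le_exp_mul_mgf (X := fun x : ℝ => x) (μ := μ) (t := √n) (a + t / √n) hs0.le
      (integrable_exp_mul_gaussianReal _)).trans (le_of_eq ?_)
    rw [hmgf, ← Real.exp_add, hsq]
    congr 1
    field_simp
    ring
  have h2 : μ.real {y | y ≤ a - t / √n} ≤ Real.exp (1 / 2 - t) := by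
    refine (measure_le_le_exp_mul_mgf (X := fun x : ℝ => x) (μ := μ) (t := -√n) (a - t / √n)
      (by linarith) (integrable_exp_mul_gaussianReal _)).trans (le_of_eq ?_)
    rw [hmgf, ← Real.exp_add, neg_sq, hsq]
    congr 1
    field_simp
    ring
  have h3 : μ {y | t / √n < |y - a|} ≤ μ {y | a + t / √n ≤ y} + μ {y | y ≤ a - t / √n} := by
    refine (measure_mono ?_).trans (measure_union_le _ _)
    intro y hy
    rcases lt_abs.1 (show t / √n < |y - a| from hy) with h | h
    · left; show a + t / √n ≤ y; linarith
    · right; show y ≤ a - t / √n; linarith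
  refine h3.trans ?_
  rw [two_mul, ENNReal.ofReal_add (Real.exp_pos _).le (Real.exp_pos _).le]
  refine add_le_add ?_ ?_
  · rw [← ofReal_measureReal]; exact ENNReal.ofReal_le_ofReal h1
  · rw [← ofReal_measureReal]; exact ENNReal.ofReal_le_ofReal h2

/-! ### Posterior risk of one coordinate under a heavy-tailed prior. -/

theorem gaussianPDFReal_inv_nat {n : ℕ} (hn : n ≠ 0) (θ y : ℝ) :
    gaussianPDFReal θ (n : ℝ≥0)⁻¹ y
      = (√(2 * Real.pi * (n : ℝ)⁻¹))⁻¹ * Real.exp (-(n * (y - θ) ^ 2 / 2)) := by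
  have hn' : (n : ℝ) ≠ 0 := by exact_mod_cast hn
  rw [gaussianPDFReal]
  push_cast
  congr 2
  field_simp

theorem le_evidence_of_forall_mem {H : Measure ℝ} {s y m : ℝ} {v : ℝ≥0} {A : Set ℝ}
    (hA : MeasurableSet A) (hm : ∀ z ∈ A, m ≤ gaussianPDFReal (s * z) v y) :
    ENNReal.ofReal m * H A ≤ evidence H s v y := by
  calc ENNReal.ofReal m * H A = ∫⁻ _ in A, ENNReal.ofReal m ∂H := by simp
    _ ≤ ∫⁻ z in A, gaussianPDF (s * z) v y ∂H :=
      setLIntegral_mono' hA fun z hz => ENNReal.ofReal_le_ofReal (hm z hz)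
    _ ≤ _ := setLIntegral_le_lintegral _ _

theorem le_withDensity_Icc {h : ℝ → ℝ} {a b m : ℝ} (hm : ∀ z ∈ Set.Icc a b, m ≤ h z) :
    ENNReal.ofReal m * ENNReal.ofReal (b - a)
      ≤ (volume.withDensity fun x => ENNReal.ofReal (h x)) (Set.Icc a b) := by
  rw [withDensity_apply _ measurableSet_Icc, ← Real.volume_Icc, ← setLIntegral_const]
  exact setLIntegral_mono' measurableSet_Icc fun z hz => ENNReal.ofReal_le_ofReal (hm z hz)

namespace IsHeavyTailed

variable {h : ℝ → ℝ} {c₁ κ : ℝ} (hh : IsHeavyTailed h c₁ κ)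

include hh

theorem apply_abs (x : ℝ) : h |x| = h x := by
  rcases abs_choice x with e | e <;> rw [e]
  exact hh.symm x

theorem le_of_abs_le {x u : ℝ} (hx : |x| ≤ u) : h u ≤ h x := by
  rw [← hh.apply_abs x]
  exact hh.anti (abs_nonneg x) ((abs_nonneg x).trans hx) hx

theorem exp_neg_le {u : ℝ} (hu : 0 ≤ u) :
    Real.exp (-(c₁ * (1 + Real.log (1 + u) ^ (1 + κ)))) ≤ h u := by
  have h1 := hh.tail u hu
  rw [one_div, Real.log_inv] at h1
  rw [← Real.le_log_iff_exp_le (hh.pos u)]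
  linarith

theorem measurable : Measurable h := by
  have hanti : Antitone fun x => h (max x 0) := fun x y hxy =>
    hh.anti (Set.mem_Ici.2 (le_max_right x 0)) (Set.mem_Ici.2 (le_max_right y 0))
      (max_le_max_right 0 hxy)
  have : h = fun x => (fun x => h (max x 0)) |x| := by
    funext x
    simp [hh.apply_abs]
  rw [this]
  exact hanti.measurable.comp measurable_id.abs

end IsHeavyTailed

theorem sq_mul_exp_le {u w T : ℝ} (hu : |u| ≤ T) (hw : 4 * T < |w|) :
    w ^ 2 * Real.exp (-((u - w) ^ 2 / 2)) ≤ 8 * Real.exp (-(2 * T ^ 2)) := by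
  have hT : 0 ≤ T := (abs_nonneg u).trans hu
  have h1 : |w| - |u| ≤ |u - w| := by rw [abs_sub_comm]; exact abs_sub_abs_le_abs_sub w u
  have h2 : 3 / 4 * |w| ≤ |u - w| := by linarith
  have h3 : 9 / 16 * w ^ 2 ≤ (u - w) ^ 2 := by
    rw [← sq_abs w, ← sq_abs (u - w)]
    nlinarith [abs_nonneg w]
  have h4 : 16 * T ^ 2 ≤ w ^ 2 := by
    rw [← sq_abs w]; nlinarith
  have h5 : w ^ 2 / 8 ≤ Real.exp (w ^ 2 / 8) := by linarith [Real.add_one_le_exp (w ^ 2 / 8)]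
  calc w ^ 2 * Real.exp (-((u - w) ^ 2 / 2))
      ≤ (8 * Real.exp (w ^ 2 / 8)) * Real.exp (-(w ^ 2 / 4)) := by
        refine mul_le_mul (by linarith) (Real.exp_le_exp.2 (by linarith [sq_nonneg w]))
          (Real.exp_pos _).le (by positivity)
    _ = 8 * Real.exp (-(w ^ 2 / 8)) := by
        rw [mul_assoc, ← Real.exp_add]; congr 2; ring
    _ ≤ _ := by gcongr; linarith

section CoordinateRisk

variable {H : Measure ℝ} [IsProbabilityMeasure H] {h : ℝ → ℝ} {c₁ κ : ℝ}
  (hH : H = volume.withDensity fun x => ENNReal.ofReal (h x)) (hh : IsHeavyTailed h c₁ κ)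
  {n : ℕ} (hn : n ≠ 0)

include hH hh hn

/-- Values of the parameter within 4T/√n of `a` contribute at most 16T²/n. Farther values carry
likelihood of order exp(-2T²), and `hT` makes this smaller than the evidence coming from prior mass
near `a`. -/
theorem coordPosterior_sq_sub_le {s a B t T y : ℝ} (hs : 0 < s) (ha : |a| ≤ B)
    (hy : |y - a| ≤ t / √n) (htT : t ≤ T)
    (hT : c₁ * (1 + Real.log (1 + (B + 1) / s) ^ (1 + κ)) + (t + 1) ^ 2 / 2 + Real.log n ≤ T ^ 2) :
    coordPosterior H s (n : ℝ≥0)⁻¹ (fun θ => ENNReal.ofReal ((θ - a) ^ 2)) y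
      ≤ ENNReal.ofReal ((16 * T ^ 2 + 8 * s) / n) := by
  have hn' : (0 : ℝ) < n := by positivity
  have hn1 : (1 : ℝ) ≤ n := by exact_mod_cast Nat.one_le_iff_ne_zero.2 hn
  have hsq : √(n : ℝ) ^ 2 = n := Real.sq_sqrt hn'.le
  have hs0 : 0 < √(n : ℝ) := Real.sqrt_pos.2 hn'
  have hs1 : 1 ≤ √(n : ℝ) := Real.one_le_sqrt.2 hn1
  have hlog : 0 ≤ Real.log n := Real.log_nonneg hn1
  have hB : 0 ≤ B := (abs_nonneg a).trans ha
  set q := c₁ * (1 + Real.log (1 + (B + 1) / s) ^ (1 + κ)) with hq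
  set c := (√(2 * Real.pi * (n : ℝ)⁻¹))⁻¹ with hc
  have hc0 : 0 < c := by positivity
  have hu : |√n * (y - a)| ≤ t := by
    rw [abs_mul, abs_of_pos hs0, mul_comm]
    exact (le_div_iff₀ hs0).1 hy
  have ht0 : 0 ≤ t := (abs_nonneg _).trans hu
  set D := evidence H s (n : ℝ≥0)⁻¹ y with hD
  -- Restrict the evidence to parameters `s z` in [a, a + 1/√n]: the interval of `z` has length
  -- 1/(s√n), the prior density there is at least exp(-q), and the standardized residual is at most
  -- t + 1.
  have hden : ENNReal.ofReal (c * Real.exp (-((t + 1) ^ 2 / 2))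
      * (Real.exp (-q) * (1 / (s * √n)))) ≤ D := by
    have h1 : ENNReal.ofReal (Real.exp (-q)) * ENNReal.ofReal ((a + 1 / √n) / s - a / s)
        ≤ H (Set.Icc (a / s) ((a + 1 / √n) / s)) := by
      rw [hH]
      refine le_withDensity_Icc fun z hz => (hh.exp_neg_le (by positivity)).trans
        (hh.le_of_abs_le ?_)
      have h2 := (div_le_iff₀ hs).1 hz.1
      have h3 := (le_div_iff₀ hs).1 hz.2
      have h4 : 1 / √(n : ℝ) ≤ 1 := (div_le_one hs0).2 hs1
      have h5 := abs_le.1 ha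
      rw [le_div_iff₀ hs]
      nth_rewrite 1 [← abs_of_pos hs]
      rw [← abs_mul, abs_le]
      constructor <;> linarith
    have h2 := le_evidence_of_forall_mem (H := H) (s := s) (y := y) (v := (n : ℝ≥0)⁻¹)
      (m := c * Real.exp (-((t + 1) ^ 2 / 2)))
      (A := Set.Icc (a / s) ((a + 1 / √n) / s)) measurableSet_Icc (by
        intro z hz
        rw [gaussianPDFReal_inv_nat hn]
        have h2 := (div_le_iff₀ hs).1 hz.1
        have h3 := (le_div_iff₀ hs).1 hz.2
        have h6 : n * (y - s * z) ^ 2 ≤ (t + 1) ^ 2 := by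
          have e : (n : ℝ) * (y - s * z) ^ 2 = (√n * (y - a) - √n * (s * z - a)) ^ 2 := by
            rw [← mul_sub, mul_pow, hsq]; ring
          have h7 : |√n * (s * z - a)| ≤ 1 := by
            rw [abs_of_nonneg (mul_nonneg hs0.le (by linarith)), mul_comm, ← le_div_iff₀ hs0]
            linarith
          rw [e]
          refine sq_le_sq' ?_ ?_ <;> linarith [abs_le.1 hu, abs_le.1 h7]
        gcongr)
    refine le_trans ?_ h2
    rw [ENNReal.ofReal_mul (by positivity)]
    gcongr
    refine le_trans (le_of_eq ?_) h1
    rw [← ENNReal.ofReal_mul (by positivity)]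
    congr 2
    field_simp
    ring
  have hnum : ∫⁻ z, ENNReal.ofReal ((s * z - a) ^ 2) * gaussianPDF (s * z) (n : ℝ≥0)⁻¹ y ∂H
      ≤ ENNReal.ofReal (16 * T ^ 2 / n) * D
        + ENNReal.ofReal (8 / n * Real.exp (-(2 * T ^ 2)) * c) := by
    have hpt : ∀ z, ENNReal.ofReal ((s * z - a) ^ 2) * gaussianPDF (s * z) (n : ℝ≥0)⁻¹ y
        ≤ ENNReal.ofReal (16 * T ^ 2 / n) * gaussianPDF (s * z) (n : ℝ≥0)⁻¹ y
          + ENNReal.ofReal (8 / n * Real.exp (-(2 * T ^ 2)) * c) := by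
      intro z
      set w := √n * (s * z - a) with hw
      have e1 : (s * z - a) ^ 2 = w ^ 2 / n := by
        rw [hw, mul_pow, hsq]; field_simp
      rcases le_or_gt |w| (4 * T) with h1 | h1
      · refine le_trans ?_ le_self_add
        gcongr
        rw [e1, ← sq_abs]
        gcongr
        nlinarith [abs_nonneg w]
      · refine le_trans ?_ le_add_self
        rw [gaussianPDF, ← ENNReal.ofReal_mul (sq_nonneg _)]
        refine ENNReal.ofReal_le_ofReal ?_
        have e : (n : ℝ) * (y - s * z) ^ 2 = (√n * (y - a) - w) ^ 2 := by
          rw [hw, ← mul_sub, mul_pow, hsq]; ring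
        rw [gaussianPDFReal_inv_nat hn, e, e1]
        have := sq_mul_exp_le (hu.trans htT) h1
        calc w ^ 2 / n * (c * Real.exp (-((√n * (y - a) - w) ^ 2 / 2)))
            = (w ^ 2 * Real.exp (-((√n * (y - a) - w) ^ 2 / 2))) * (c / n) := by ring
          _ ≤ (8 * Real.exp (-(2 * T ^ 2))) * (c / n) := by gcongr
          _ = _ := by ring
    refine (lintegral_mono hpt).trans (le_of_eq ?_)
    rw [lintegral_add_right _ measurable_const,
      lintegral_const_mul _ (measurable_gaussianPDF_mul_left s _ y), lintegral_const, measure_univ,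
      mul_one, hD, evidence]
  refine ENNReal.div_le_of_le_mul (hnum.trans ?_)
  rw [add_div, ENNReal.ofReal_add (by positivity) (by positivity), add_mul]
  gcongr
  refine (ENNReal.ofReal_le_ofReal ?_).trans ((ENNReal.ofReal_mul (by positivity)).le.trans
    (mul_le_mul_right hden (ENNReal.ofReal (8 * s / n))))
  have hsn : √(n : ℝ) ≤ Real.exp (Real.log n) := by
    rw [Real.exp_log hn']
    nlinarith
  -- The three terms of `hT` pay for the three factors; the term log n gives even 1/n ≤ 1/√n.
  have hexp : Real.exp (-(2 * T ^ 2)) ≤ Real.exp (-((t + 1) ^ 2 / 2)) * Real.exp (-q) * (1 / √n) := by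
    calc Real.exp (-(2 * T ^ 2))
        ≤ Real.exp (-((t + 1) ^ 2 / 2) + -q + -Real.log n) :=
          Real.exp_le_exp.2 (by nlinarith [sq_nonneg T])
      _ = Real.exp (-((t + 1) ^ 2 / 2)) * Real.exp (-q) * (1 / Real.exp (Real.log n)) := by
          rw [Real.exp_add, Real.exp_add, Real.exp_neg (Real.log n), one_div]
      _ ≤ _ := by gcongr
  calc 8 / n * Real.exp (-(2 * T ^ 2)) * c
      ≤ 8 / n * (Real.exp (-((t + 1) ^ 2 / 2)) * Real.exp (-q) * (1 / √n)) * c := by gcongr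
    _ = _ := by field_simp

/-- The data density is at most a constant times the evidence on the truncation set. Averaging the
posterior second moment over the data therefore cancels its denominator and leaves a constant times
the prior second moment `s² E ζ²`; the bias adds `2a²`. -/
theorem setLIntegral_coordPosterior_sq_sub_le {s a C t : ℝ}
    (hmom : ∫⁻ z, ENNReal.ofReal (z ^ 2) ∂H ≠ ∞) (hs : 0 < s)
    (hC : s * √n ≤ C) (ht : 1 ≤ t) (ha : |a| ≤ 1 / (√n * t)) :
    ∫⁻ y in {y | |y - a| ≤ t / √n},
        coordPosterior H s (n : ℝ≥0)⁻¹ (fun θ => ENNReal.ofReal ((θ - a) ^ 2)) y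
        ∂(gaussianReal a (n : ℝ≥0)⁻¹)
      ≤ ENNReal.ofReal (2 * a ^ 2 + 2 * Real.exp (2 + C ^ 2 / 2) / h 1
          * (∫⁻ z, ENNReal.ofReal (z ^ 2) ∂H).toReal * s ^ 2) := by
  have hn' : (0 : ℝ) < n := by positivity
  have hv : (n : ℝ≥0)⁻¹ ≠ 0 := by simpa using hn
  have hsq : √(n : ℝ) ^ 2 = n := Real.sq_sqrt hn'.le
  have hs0 : 0 < √(n : ℝ) := Real.sqrt_pos.2 hn'
  have hh1 : 0 < h 1 := hh.pos 1
  set v := (n : ℝ≥0)⁻¹ with hvdef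
  set c := (√(2 * Real.pi * (n : ℝ)⁻¹))⁻¹ with hc
  have hc0 : 0 < c := by positivity
  set K := Real.exp (2 + C ^ 2 / 2) / h 1 with hK
  set N : ℝ → ℝ≥0∞ := fun y => ∫⁻ z, ENNReal.ofReal ((s * z) ^ 2) * gaussianPDF (s * z) v y ∂H
    with hN
  have hS : MeasurableSet {y : ℝ | |y - a| ≤ t / √n} :=
    measurableSet_le (by fun_prop) measurable_const
  have hNm : Measurable N := measurable_coordPosterior_num H s (g := fun θ => ENNReal.ofReal (θ ^ 2))
    (by fun_prop)
  have hDm : Measurable (evidence H s v) := measurable_evidence H s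
  -- the marginal density dominates the density of the centred noise, hence that of the data
  have hD0 : ∀ y, ENNReal.ofReal (gaussianPDFReal 0 v y * Real.exp (-(C ^ 2 / 2)) * h 1)
      ≤ evidence H s v y := by
    intro y
    -- The unit interval of `z` is taken on the side of 0 where `y` lies, so the cross term in the
    -- Gaussian exponent can only increase the likelihood.
    have main : ∀ b : ℝ, (∀ z ∈ Set.Icc b (b + 1), |z| ≤ 1 ∧ 0 ≤ y * z) →
        ENNReal.ofReal (gaussianPDFReal 0 v y * Real.exp (-(C ^ 2 / 2)) * h 1)
          ≤ evidence H s v y := by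
      intro b hb
      have h1 := le_withDensity_Icc (h := h) (a := b) (b := b + 1) (m := h 1)
        fun z hz => hh.le_of_abs_le (hb z hz).1
      rw [← hH, add_sub_cancel_left, ENNReal.ofReal_one, mul_one] at h1
      have h2 := le_evidence_of_forall_mem (H := H) (s := s) (y := y) (v := v)
        (m := gaussianPDFReal 0 v y * Real.exp (-(C ^ 2 / 2)))
        (A := Set.Icc b (b + 1)) measurableSet_Icc (by
          intro z hz
          obtain ⟨hz1, hz2⟩ := hb z hz
          rw [gaussianPDFReal_inv_nat hn, gaussianPDFReal_inv_nat hn, mul_assoc, ← Real.exp_add]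
          have h3 : (s * √n) ^ 2 * z ^ 2 ≤ C ^ 2 * 1 := by
            have : z ^ 2 ≤ 1 := by rw [← sq_abs]; nlinarith [abs_nonneg z]
            gcongr
          rw [mul_pow, hsq] at h3
          have h4 : 0 ≤ n * s * (y * z) := by positivity
          gcongr
          nlinarith)
      refine le_trans ?_ h2
      rw [ENNReal.ofReal_mul (by have := gaussianPDFReal_nonneg 0 v y; positivity)]
      gcongr
    rcases le_total 0 y with hy | hy
    · refine main 0 fun z hz => ⟨?_, ?_⟩
      · rw [abs_le]; constructor <;> linarith [hz.1, hz.2]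
      · exact mul_nonneg hy hz.1
    · refine main (-1) fun z hz => ⟨?_, ?_⟩
      · rw [abs_le]; constructor <;> linarith [hz.1, hz.2]
      · exact mul_nonneg_of_nonpos_of_nonpos hy (by linarith [hz.2])
  have hden : ∀ y, |y - a| ≤ t / √n → gaussianPDF a v y ≤ ENNReal.ofReal K * evidence H s v y := by
    intro y hy
    refine le_trans ?_ (mul_le_mul_right (hD0 y) _)
    rw [gaussianPDF, ← ENNReal.ofReal_mul (by positivity)]
    refine ENNReal.ofReal_le_ofReal ?_
    have h1 : K * (gaussianPDFReal 0 v y * Real.exp (-(C ^ 2 / 2)) * h 1)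
        = gaussianPDFReal 0 v y * Real.exp 2 := by
      rw [hK, Real.exp_add, Real.exp_neg]; field_simp
    rw [h1, gaussianPDFReal_inv_nat hn, gaussianPDFReal_inv_nat hn,
      mul_assoc _ (Real.exp _) (Real.exp 2), ← Real.exp_add]
    have h2 : |√n * (y - a)| ≤ t := by
      rw [abs_mul, abs_of_pos hs0, mul_comm]; exact (le_div_iff₀ hs0).1 hy
    have h3 : |√n * a| ≤ 1 / t := by
      rw [abs_mul, abs_of_pos hs0]
      calc √n * |a| ≤ √n * (1 / (√n * t)) := by gcongr
        _ = 1 / t := by field_simp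
    -- This is why the threshold for small coefficients carries the factor 1/t: the log-likelihood
    -- ratio between means `a` and 0 is at most 1 + 1/2.
    have h4 : (√n * (y - a)) * (√n * a) ≤ 1 := by
      refine (le_abs_self _).trans ?_
      rw [abs_mul]
      calc _ ≤ t * (1 / t) := by gcongr
        _ = 1 := by field_simp
    have h5 : (√n * a) ^ 2 ≤ 1 := by
      rw [← sq_abs]
      have : |√n * a| ≤ 1 := h3.trans (by rw [div_le_one (by linarith)]; exact ht)
      nlinarith [abs_nonneg (√n * a)]
    have h6 : (√n * (y - a)) * (√n * a) = n * (y - a) * a := by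
      linear_combination ((y - a) * a) * hsq
    rw [mul_pow, hsq] at h5
    gcongr
    nlinarith
  have hpt : ∀ y, coordPosterior H s v (fun θ => ENNReal.ofReal ((θ - a) ^ 2)) y
      ≤ ENNReal.ofReal (2 * a ^ 2) + 2 * (N y / evidence H s v y) := by
    intro y
    have h1 : ∫⁻ z, ENNReal.ofReal ((s * z - a) ^ 2) * gaussianPDF (s * z) v y ∂H
        ≤ ENNReal.ofReal (2 * a ^ 2) * evidence H s v y + 2 * N y := by
      have hm : Measurable fun z => ENNReal.ofReal ((s * z) ^ 2) * gaussianPDF (s * z) v y :=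
        Measurable.mul (by fun_prop) (measurable_gaussianPDF_mul_left s v y)
      simp only [hN]
      rw [evidence, ← lintegral_const_mul _ (measurable_gaussianPDF_mul_left s v y),
        ← lintegral_const_mul _ hm, ← lintegral_add_left ((measurable_gaussianPDF_mul_left s v y).const_mul _)]
      refine lintegral_mono fun z => ?_
      rw [← mul_assoc, ← add_mul]
      gcongr
      rw [← ENNReal.ofReal_ofNat 2, ← ENNReal.ofReal_mul (by norm_num),
        ← ENNReal.ofReal_add (by positivity) (by positivity)]
      exact ENNReal.ofReal_le_ofReal (by nlinarith [sq_nonneg (s * z + a)])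
    refine ENNReal.div_le_of_le_mul (h1.trans (le_of_eq ?_))
    rw [add_mul, mul_assoc, ENNReal.div_mul_cancel (evidence_ne_zero H s hv y)
      (evidence_ne_top H s y)]
  have hNint : ∫⁻ y, N y = ENNReal.ofReal (s ^ 2) * ∫⁻ z, ENNReal.ofReal (z ^ 2) ∂H := by
    rw [hN, lintegral_lintegral_swap ((Measurable.mul (by fun_prop)
      (measurable_gaussianPDF_mul s v) : Measurable fun p : ℝ × ℝ =>
        ENNReal.ofReal ((s * p.2) ^ 2) * gaussianPDF (s * p.2) v p.1).aemeasurable),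
      ← lintegral_const_mul _ (by fun_prop)]
    refine lintegral_congr fun z => ?_
    rw [lintegral_const_mul _ (measurable_gaussianPDF _ _), lintegral_gaussianPDF_eq_one _ hv,
      mul_one, mul_pow, ENNReal.ofReal_mul (sq_nonneg s)]
  have hq : Measurable fun y => N y / evidence H s v y := hNm.div hDm
  set S := {y : ℝ | |y - a| ≤ t / √n}
  calc ∫⁻ y in S, coordPosterior H s v (fun θ => ENNReal.ofReal ((θ - a) ^ 2)) y
        ∂(gaussianReal a v)
      ≤ ∫⁻ y in S, (ENNReal.ofReal (2 * a ^ 2) + 2 * (N y / evidence H s v y))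
        ∂(gaussianReal a v) := lintegral_mono fun y => hpt y
    _ = ENNReal.ofReal (2 * a ^ 2) * gaussianReal a v S
        + 2 * ∫⁻ y in S, N y / evidence H s v y ∂(gaussianReal a v) := by
        rw [lintegral_add_left measurable_const, setLIntegral_const,
          lintegral_const_mul _ hq]
    _ ≤ ENNReal.ofReal (2 * a ^ 2) * 1
        + 2 * (ENNReal.ofReal K * ∫⁻ y, N y) := by
        gcongr
        · exact prob_le_one
        · rw [gaussianReal_of_var_ne_zero _ hv, setLIntegral_withDensity_eq_setLIntegral_mul _
            (measurable_gaussianPDF a v) hq hS, ← lintegral_const_mul _ hNm]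
          refine le_trans (setLIntegral_mono' hS fun y hy => ?_) (setLIntegral_le_lintegral S _)
          calc gaussianPDF a v y * (N y / evidence H s v y)
              ≤ (ENNReal.ofReal K * evidence H s v y) * (N y / evidence H s v y) := by
                gcongr; exact hden y hy
            _ = _ := by
                rw [mul_assoc, ENNReal.mul_div_cancel (evidence_ne_zero H s hv y)
                  (evidence_ne_top H s y)]
    _ = _ := by
        have h2 : (2 : ℝ≥0∞) = ENNReal.ofReal 2 := by simp
        rw [hNint, mul_one, ← ENNReal.ofReal_toReal hmom, h2,
          ← ENNReal.ofReal_mul (by positivity), ← ENNReal.ofReal_mul (by positivity),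
          ← ENNReal.ofReal_mul (by positivity), ← ENNReal.ofReal_add (by positivity)
            (by positivity), ENNReal.toReal_ofReal ENNReal.toReal_nonneg]
        congr 1
        rw [hK]
        ring

end CoordinateRisk

/-! ### Truncation radii and their total tail probability. -/

theorem two_rpow_mul_natCast (c : ℝ) (l : ℕ) : (2 : ℝ) ^ (c * l) = ((2 : ℝ) ^ l) ^ c := by
  rw [← Real.rpow_natCast, ← Real.rpow_mul (by norm_num), mul_comm]

/-- The truncation radius, in units of the noise level, for the observations of level `l`. -/
noncomputable def truncRadius (n l : ℕ) : ℝ := 2 * (1 + l + Real.log n)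

theorem log_nat_nonneg (n : ℕ) : 0 ≤ Real.log n := Real.log_natCast_nonneg n

theorem two_le_truncRadius (n l : ℕ) : 2 ≤ truncRadius n l := by
  have := log_nat_nonneg n
  have : (0 : ℝ) ≤ l := by positivity
  rw [truncRadius]; linarith

/-- The term 2l in the radius beats the 2^l coefficients of a level, and the term 2 log n leaves a
factor 1/n. -/
theorem tsum_gaussianReal_tail_le (a : WaveletIndex → ℝ) {n : ℕ} (hn : n ≠ 0) :
    ∑' i : WaveletIndex, gaussianReal (a i) (n : ℝ≥0)⁻¹ {y | truncRadius n i.1 / √n < |y - a i|}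
      ≤ ENNReal.ofReal (4 / n) := by
  have hn' : (0 : ℝ) < n := by positivity
  have hn1 : (1 : ℝ) ≤ n := by exact_mod_cast Nat.one_le_iff_ne_zero.2 hn
  have hterm : ∀ l : ℕ, (2 : ℝ) ^ l * (2 * Real.exp (1 / 2 - truncRadius n l))
      ≤ 2 / n * (1 / 2) ^ l := by
    intro l
    have h1 : Real.exp (1 / 2 - truncRadius n l)
        ≤ Real.exp (-Real.log n) * Real.exp (-(2 * l : ℝ)) := by
      rw [← Real.exp_add]
      refine Real.exp_le_exp.2 ?_
      have := log_nat_nonneg n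
      rw [truncRadius]; linarith
    have h2 : Real.exp (-(2 * l : ℝ)) ≤ (1 / 4) ^ l := by
      have : Real.exp (-2 : ℝ) ≤ 1 / 4 := by
        rw [Real.exp_neg, one_div]
        refine inv_anti₀ (by norm_num) ?_
        have h3 : (2 : ℝ) ≤ Real.exp 1 := by linarith [Real.add_one_le_exp (1 : ℝ)]
        have h4 : Real.exp 2 = Real.exp 1 * Real.exp 1 := by rw [← Real.exp_add]; norm_num
        nlinarith
      calc Real.exp (-(2 * l : ℝ)) = Real.exp (-2) ^ l := by rw [← Real.exp_nat_mul]; ring_nf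
        _ ≤ _ := by gcongr
    rw [Real.exp_neg, Real.exp_log hn'] at h1
    calc (2 : ℝ) ^ l * (2 * Real.exp (1 / 2 - truncRadius n l))
        ≤ 2 ^ l * (2 * ((n : ℝ)⁻¹ * (1 / 4) ^ l)) := by
          gcongr; exact h1.trans (by gcongr)
      _ = 2 / n * (2 * (1 / 4)) ^ l := by rw [mul_pow]; ring
      _ = _ := by norm_num
  calc _ ≤ ∑' i : WaveletIndex, ENNReal.ofReal (2 * Real.exp (1 / 2 - truncRadius n i.1)) :=
        ENNReal.tsum_le_tsum fun i => gaussianReal_tail_le _ hn _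
    _ = ∑' l : ℕ, ENNReal.ofReal (2 ^ l * (2 * Real.exp (1 / 2 - truncRadius n l))) := by
        rw [ENNReal.tsum_sigma']
        refine tsum_congr fun l => ?_
        rw [tsum_fintype]
        simp only
        rw [Finset.sum_const, Finset.card_univ, Fintype.card_fin, nsmul_eq_mul,
          ENNReal.ofReal_mul (by positivity)]
        simp [ENNReal.ofReal_pow]
    _ ≤ ∑' l : ℕ, ENNReal.ofReal (2 / n * (1 / 2) ^ l) :=
        ENNReal.tsum_le_tsum fun l => ENNReal.ofReal_le_ofReal (hterm l)
    _ = _ := by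
        rw [← ENNReal.ofReal_tsum_of_nonneg (fun l => by positivity)
          (summable_geometric_two.mul_left _), tsum_mul_left, tsum_geometric_two]
        congr 1; ring

theorem level_le_mul_log_of_low {β : ℝ} {n l : ℕ} (hn : n ≠ 0)
    (hl : (2 : ℝ) ^ l < (n : ℝ) ^ (2 * β + 1)⁻¹) :
    (l : ℝ) ≤ (2 * β + 1)⁻¹ / Real.log 2 * Real.log n := by
  have hn' : (0 : ℝ) < n := by positivity
  have h := Real.log_le_log (by positivity) hl.le
  rw [Real.log_pow, Real.log_rpow hn'] at h
  rw [div_mul_eq_mul_div, le_div_iff₀ (Real.log_pos (by norm_num))]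
  exact h

/-! ### Counting large coefficients and summing small ones in a Besov ball. -/

section Besov

variable {β L r : ℝ} (hβ : 0 < β) (hL : 0 < L) (hr₁ : 1 ≤ r) (hβr : 1 / r - 1 / 2 < β)
  {a : WaveletIndex → ℝ}
  (ha : ∑' l : ℕ, ENNReal.ofReal ((2 : ℝ) ^ (r * l * (β + 1 / 2 - 1 / r))
    * ∑ k : Fin (2 ^ l), |a ⟨l, k⟩| ^ r) < ENNReal.ofReal (L ^ r))

include hr₁ ha hL

omit hr₁ in
theorem level_weight_lt (l : ℕ) :
    (2 : ℝ) ^ (r * l * (β + 1 / 2 - 1 / r)) * ∑ k : Fin (2 ^ l), |a ⟨l, k⟩| ^ r < L ^ r :=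
  (ENNReal.ofReal_lt_ofReal_iff (by positivity)).1 ((ENNReal.le_tsum l).trans_lt ha)

theorem two_rpow_mul_abs_lt (i : WaveletIndex) :
    ((2 : ℝ) ^ i.1) ^ (β + 1 / 2 - 1 / r) * |a i| < L := by
  obtain ⟨l, k⟩ := i
  have h1 := level_weight_lt hL ha l
  have h2 : |a ⟨l, k⟩| ^ r ≤ ∑ k : Fin (2 ^ l), |a ⟨l, k⟩| ^ r :=
    Finset.single_le_sum (f := fun k => |a ⟨l, k⟩| ^ r) (fun _ _ => by positivity)
      (Finset.mem_univ k)
  refine (Real.rpow_lt_rpow_iff (by positivity) hL.le (by linarith : 0 < r)).1 ?_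
  rw [Real.mul_rpow (by positivity) (abs_nonneg _), ← two_rpow_mul_natCast,
    ← Real.rpow_mul (by norm_num)]
  refine lt_of_le_of_lt ?_ h1
  rw [show (β + 1 / 2 - 1 / r) * l * r = r * l * (β + 1 / 2 - 1 / r) by ring]
  gcongr

include hβr

theorem abs_le_of_besov (i : WaveletIndex) : |a i| ≤ L := by
  refine le_trans ?_ (two_rpow_mul_abs_lt hL hr₁ ha i).le
  refine le_mul_of_one_le_left (abs_nonneg _) (Real.one_le_rpow (one_le_pow₀ (by norm_num)) ?_)
  linarith

include hβ

omit hL ha in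
-- With N = n^(1/(2β+1)), the Besov weight at 2^l = N equals exactly n^(r/2)/N, and it increases
-- with `l` because β + 1/2 - 1/r > 0.
theorem sum_abs_rpow_le {n l : ℕ} (hn : n ≠ 0) (hl : (n : ℝ) ^ (2 * β + 1)⁻¹ ≤ 2 ^ l) :
    ∑ k : Fin (2 ^ l), |a ⟨l, k⟩| ^ r ≤ (n : ℝ) ^ ((2 * β + 1)⁻¹ - r / 2)
      * ((2 : ℝ) ^ (r * l * (β + 1 / 2 - 1 / r)) * ∑ k : Fin (2 ^ l), |a ⟨l, k⟩| ^ r) := by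
  have hn' : (0 : ℝ) < n := by positivity
  have hr0 : 0 < r := by linarith
  have hδ : 0 < β + 1 / 2 - 1 / r := by linarith
  rw [← mul_assoc]
  refine le_mul_of_one_le_left (Finset.sum_nonneg fun _ _ => by positivity) ?_
  rw [show r * l * (β + 1 / 2 - 1 / r) = (r * (β + 1 / 2 - 1 / r)) * l by ring,
    two_rpow_mul_natCast]
  calc (1 : ℝ) = (n : ℝ) ^ ((2 * β + 1)⁻¹ - r / 2)
        * ((n : ℝ) ^ (2 * β + 1)⁻¹) ^ (r * (β + 1 / 2 - 1 / r)) := by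
        rw [← Real.rpow_mul hn'.le, ← Real.rpow_add hn']
        have : (2 * β + 1)⁻¹ - r / 2 + (2 * β + 1)⁻¹ * (r * (β + 1 / 2 - 1 / r)) = 0 := by
          field_simp; ring
        rw [this, Real.rpow_zero]
    _ ≤ _ := by gcongr

/-- Markov's inequality for the r-th power sum; the factor `t ^ r` is at most `t ^ 2` since `t ≥ 2`.
-/
theorem card_large_le {n l : ℕ} (hn : n ≠ 0) (hr₂ : r ≤ 2)
    (hl : (n : ℝ) ^ (2 * β + 1)⁻¹ ≤ 2 ^ l) :
    ((Finset.univ.filter fun k : Fin (2 ^ l) => 1 / (√n * truncRadius n l) < |a ⟨l, k⟩|).card : ℝ)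
      ≤ (n : ℝ) ^ (2 * β + 1)⁻¹ * (L ^ r * truncRadius n l ^ 2) := by
  have hn' : (0 : ℝ) < n := by positivity
  have hs0 : 0 < √(n : ℝ) := Real.sqrt_pos.2 hn'
  have hr0 : 0 < r := by linarith
  have ht := two_le_truncRadius n l
  set t := truncRadius n l
  have ht0 : 0 < t := by linarith
  set A := Finset.univ.filter fun k : Fin (2 ^ l) => 1 / (√n * t) < |a ⟨l, k⟩|
  have h1 : (A.card : ℝ) ≤ ∑ k : Fin (2 ^ l), (√n * t) ^ r * |a ⟨l, k⟩| ^ r := by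
    calc (A.card : ℝ) = ∑ k ∈ A, (1 : ℝ) := by simp
      _ ≤ ∑ k ∈ A, (√n * t) ^ r * |a ⟨l, k⟩| ^ r := by
          refine Finset.sum_le_sum fun k hk => ?_
          have hk' : 1 / (√n * t) < |a ⟨l, k⟩| := (Finset.mem_filter.1 hk).2
          rw [← Real.mul_rpow (by positivity) (abs_nonneg _)]
          refine Real.one_le_rpow ?_ hr0.le
          rw [div_lt_iff₀ (by positivity)] at hk'
          linarith
      _ ≤ _ := Finset.sum_le_sum_of_subset_of_nonneg (Finset.subset_univ _)
          fun _ _ _ => by positivity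
  rw [← Finset.mul_sum] at h1
  have h2 := sum_abs_rpow_le (a := a) hβ hr₁ hβr hn hl
  have h3 := (level_weight_lt hL ha l).le
  calc (A.card : ℝ) ≤ (√n * t) ^ r * ((n : ℝ) ^ ((2 * β + 1)⁻¹ - r / 2) * L ^ r) :=
        h1.trans (by gcongr; exact h2.trans (by gcongr))
    _ = ((n : ℝ) ^ (r / 2) * (n : ℝ) ^ ((2 * β + 1)⁻¹ - r / 2)) * (L ^ r * t ^ r) := by
        rw [Real.mul_rpow hs0.le ht0.le, Real.sqrt_eq_rpow, ← Real.rpow_mul hn'.le]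
        ring_nf
    _ = (n : ℝ) ^ (2 * β + 1)⁻¹ * (L ^ r * t ^ r) := by
        rw [← Real.rpow_add hn']; congr 2; ring
    _ ≤ _ := by
        gcongr
        rw [← Real.rpow_natCast t 2]
        exact Real.rpow_le_rpow_of_exponent_le (by linarith) (by exact_mod_cast hr₂)

omit hL ha in
-- Below n^(-1/2), a² ≤ n^(r/2-1)|a|^r since r ≤ 2. The weighted level sum is kept on the right,
-- rather than bounded by L^r, so that it can be summed over all levels.
theorem sum_sq_small_le {n l : ℕ} (hn : n ≠ 0) (hr₂ : r ≤ 2)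
    (hl : (n : ℝ) ^ (2 * β + 1)⁻¹ ≤ 2 ^ l) :
    ∑ k ∈ Finset.univ.filter fun k : Fin (2 ^ l) => |a ⟨l, k⟩| ≤ 1 / (√n * truncRadius n l),
      a ⟨l, k⟩ ^ 2 ≤ (n : ℝ) ^ ((2 * β + 1)⁻¹ - 1)
      * ((2 : ℝ) ^ (r * l * (β + 1 / 2 - 1 / r)) * ∑ k : Fin (2 ^ l), |a ⟨l, k⟩| ^ r) := by
  have hn' : (0 : ℝ) < n := by positivity
  have hs0 : 0 < √(n : ℝ) := Real.sqrt_pos.2 hn'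
  have hr0 : 0 < r := by linarith
  have ht := two_le_truncRadius n l
  have hpt : ∀ k : Fin (2 ^ l), |a ⟨l, k⟩| ≤ 1 / (√n * truncRadius n l) →
      a ⟨l, k⟩ ^ 2 ≤ (n : ℝ) ^ (r / 2 - 1) * |a ⟨l, k⟩| ^ r := by
    intro k hk
    have h1 : |a ⟨l, k⟩| ≤ (n : ℝ) ^ (-(1 / 2) : ℝ) := by
      refine hk.trans ?_
      rw [Real.rpow_neg hn'.le, ← Real.sqrt_eq_rpow, ← one_div]
      exact one_div_le_one_div_of_le hs0 (le_mul_of_one_le_right hs0.le (by linarith))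
    calc a ⟨l, k⟩ ^ 2 = |a ⟨l, k⟩| ^ (2 - r) * |a ⟨l, k⟩| ^ r := by
          rw [← Real.rpow_add_of_nonneg (abs_nonneg _) (by linarith) hr0.le, sub_add_cancel,
            Real.rpow_ofNat, sq_abs]
      _ ≤ ((n : ℝ) ^ (-(1 / 2) : ℝ)) ^ (2 - r) * |a ⟨l, k⟩| ^ r := by
          have : 0 ≤ 2 - r := by linarith
          gcongr
      _ = _ := by rw [← Real.rpow_mul hn'.le]; congr 2; ring
  calc _ ≤ ∑ k ∈ Finset.univ.filter fun k : Fin (2 ^ l) =>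
          |a ⟨l, k⟩| ≤ 1 / (√n * truncRadius n l), (n : ℝ) ^ (r / 2 - 1) * |a ⟨l, k⟩| ^ r :=
        Finset.sum_le_sum fun k hk => hpt k (Finset.mem_filter.1 hk).2
    _ ≤ ∑ k : Fin (2 ^ l), (n : ℝ) ^ (r / 2 - 1) * |a ⟨l, k⟩| ^ r :=
        Finset.sum_le_sum_of_subset_of_nonneg (Finset.subset_univ _)
          fun _ _ _ => by positivity
    _ ≤ (n : ℝ) ^ (r / 2 - 1) * ((n : ℝ) ^ ((2 * β + 1)⁻¹ - r / 2) * _) := by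
        rw [← Finset.mul_sum]
        gcongr
        exact sum_abs_rpow_le hβ hr₁ hβr hn hl
    _ = _ := by
        rw [← mul_assoc, ← Real.rpow_add hn']
        congr 2; ring

end Besov

/-! ### Admissible scales, logarithmic level bounds and the choice of threshold. -/

/-- Positive scales `s_l` that are at most of order `2 ^ (-l (1/2 + β))` and whose logarithms
decrease at most quadratically. -/
structure IsAdmissibleScale (s : ℕ → ℝ) (β C : ℝ) : Prop where
  one_le : 1 ≤ C
  pos : ∀ l, 0 < s l
  le : ∀ l : ℕ, s l ≤ C * ((2 : ℝ) ^ l) ^ (-(1 / 2 + β))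
  neg_log_le : ∀ l : ℕ, -Real.log (s l) ≤ C * (1 + l) ^ 2

/-- A coefficient above 1/(√n t) in the Besov ball satisfies the displayed inequality, so its level
is O(log n). The left side is exponential in `l`, while the right grows only linearly in `l`. -/
theorem exists_level_le_mul_log {δ L : ℝ} (hδ : 0 < δ) (hL : 0 < L) :
    ∃ Λ : ℝ, ∀ n l : ℕ, n ≠ 0 → 1 ≤ Real.log n →
      ((2 : ℝ) ^ l) ^ δ < L * (√n * truncRadius n l) → (l : ℝ) ≤ Λ * Real.log n := by
  have hlog2 : 0 < Real.log 2 := Real.log_pos (by norm_num)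
  -- Half the exponential growth rate: the tangent-line bound on log(1 + l + x) is given slope `η`,
  -- and the other half remains to control `l`.
  set η := δ * Real.log 2 / 2 with hη
  have hη0 : 0 < η := by positivity
  set c := |Real.log (2 * L)| + 1 / 2 + 2 * η + |Real.log η| with hc
  refine ⟨c / η, fun n l hn hx h => ?_⟩
  have hn' : (0 : ℝ) < n := by positivity
  set x := Real.log n with hxdef
  have hu : 0 < 1 + l + x := by positivity
  have h1 := Real.log_le_log (by positivity) h.le
  rw [show L * (√(n : ℝ) * truncRadius n l) = (2 * L) * (√(n : ℝ) * (1 + l + x)) by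
    rw [truncRadius]; ring, Real.log_rpow (by positivity), Real.log_pow,
    Real.log_mul (by positivity) (by positivity), Real.log_mul (by positivity) hu.ne',
    Real.log_sqrt hn'.le, ← hxdef] at h1
  have h2 : Real.log (1 + l + x) ≤ η * (1 + l + x) - 1 - Real.log η := by
    have := Real.log_le_sub_one_of_pos (mul_pos hη0 hu)
    rw [Real.log_mul hη0.ne' hu.ne'] at this
    linarith
  have h3 := le_abs_self (Real.log (2 * L))
  have h4 := neg_abs_le (Real.log η)
  rw [div_mul_eq_mul_div, le_div_iff₀ hη0]
  have h5 : (l : ℝ) * η = δ * (l * Real.log 2) - η * l := by rw [hη]; ring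
  have h6 : |Real.log (2 * L)| ≤ |Real.log (2 * L)| * x :=
    le_mul_of_one_le_right (abs_nonneg _) hx
  have h7 : |Real.log η| ≤ |Real.log η| * x := le_mul_of_one_le_right (abs_nonneg _) hx
  have h8 : η ≤ η * x := le_mul_of_one_le_right hη0.le hx
  rw [h5, hc]
  nlinarith

theorem truncRadius_le_mul_log {Λ : ℝ} {n l : ℕ} (hx : 1 ≤ Real.log n)
    (hl : (l : ℝ) ≤ Λ * Real.log n) : truncRadius n l ≤ 2 * (2 + Λ) * Real.log n := by
  rw [truncRadius]; linarith

/-- For l = O(log n), log(1/s_l) is O(log² n), which the prior tail raises to the power 1 + κ. This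
gives T² of order (log n)^(2+2κ). -/
theorem IsAdmissibleScale.exists_threshold {s : ℕ → ℝ} {β Cs c₁ κ Λ L : ℝ}
    (hs : IsAdmissibleScale s β Cs) (hβ : 0 < β) (hc₁ : 0 < c₁) (hκ : 0 ≤ κ) (hL : 0 < L)
    (hΛ : 0 ≤ Λ) :
    ∃ C : ℝ, 0 ≤ C ∧ ∀ n l : ℕ, 1 ≤ Real.log n → (l : ℝ) ≤ Λ * Real.log n →
      ∃ T : ℝ, truncRadius n l ≤ T ∧
        c₁ * (1 + Real.log (1 + (L + 1) / s l) ^ (1 + κ)) + (truncRadius n l + 1) ^ 2 / 2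
          + Real.log n ≤ T ^ 2 ∧
        16 * T ^ 2 + 8 * s l ≤ C * Real.log n ^ (2 + 2 * κ) := by
  have hCs := hs.one_le
  set A := Real.log (Cs + L + 1) + Cs * (1 + Λ) ^ 2 with hA
  have hA0 : 0 ≤ A := by
    have : 0 ≤ Real.log (Cs + L + 1) := Real.log_nonneg (by linarith)
    positivity
  set τ := 2 * (2 + Λ) with hτ
  have hτ0 : 0 ≤ τ := by positivity
  refine ⟨16 * (c₁ * (1 + A ^ (1 + κ)) + (τ + 1) ^ 2 + 1) + 8 * Cs, by positivity,
    fun n l hx hl => ?_⟩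
  set x := Real.log n with hxdef
  have hx0 : 0 ≤ x := by linarith
  have hsl := hs.pos l
  have hsC : s l ≤ Cs := (hs.le l).trans (mul_le_of_le_one_right (by linarith)
    (Real.rpow_le_one_of_one_le_of_nonpos (one_le_pow₀ (by norm_num)) (by linarith)))
  have hx1 : 1 ≤ x ^ (2 + 2 * κ) := Real.one_le_rpow hx (by linarith)
  have hx2 : x ^ 2 ≤ x ^ (2 + 2 * κ) := by
    rw [← Real.rpow_natCast x 2]
    exact Real.rpow_le_rpow_of_exponent_le hx (by push_cast; linarith)
  have hxx : x ≤ x ^ 2 := by nlinarith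
  have hlog0 : 0 ≤ Real.log (1 + (L + 1) / s l) :=
    Real.log_nonneg (by have : 0 ≤ (L + 1) / s l := by positivity
                        linarith)
  have hlog : Real.log (1 + (L + 1) / s l) ≤ A * x ^ 2 := by
    calc Real.log (1 + (L + 1) / s l) ≤ Real.log ((Cs + L + 1) / s l) := by
          refine Real.log_le_log (by positivity) ?_
          rw [show 1 + (L + 1) / s l = (s l + L + 1) / s l by field_simp; ring]
          gcongr
      _ = Real.log (Cs + L + 1) + -Real.log (s l) := by
          rw [Real.log_div (by positivity) hsl.ne']; ring
      _ ≤ Real.log (Cs + L + 1) * x ^ 2 + Cs * ((1 + Λ) * x) ^ 2 := by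
          have h1 : 0 ≤ Real.log (Cs + L + 1) := Real.log_nonneg (by linarith)
          refine add_le_add (le_mul_of_one_le_right h1 (by nlinarith))
            ((hs.neg_log_le l).trans ?_)
          gcongr
          linarith
      _ = A * x ^ 2 := by rw [hA]; ring
  have hpow : Real.log (1 + (L + 1) / s l) ^ (1 + κ) ≤ A ^ (1 + κ) * x ^ (2 + 2 * κ) := by
    calc _ ≤ (A * x ^ 2) ^ (1 + κ) := by gcongr
      _ = _ := by
          rw [Real.mul_rpow hA0 (by positivity), ← Real.rpow_natCast x 2, ← Real.rpow_mul hx0]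
          push_cast
          ring_nf
  have ht := truncRadius_le_mul_log hx hl
  have ht2 := two_le_truncRadius n l
  rw [← hτ, ← hxdef] at ht
  set t := truncRadius n l
  -- Keeping (t+1)² without the half makes √V dominate `t` as well as satisfy the risk condition.
  set V := c₁ * (1 + Real.log (1 + (L + 1) / s l) ^ (1 + κ)) + (t + 1) ^ 2 + x with hV
  have hq0 : 0 ≤ c₁ * (1 + Real.log (1 + (L + 1) / s l) ^ (1 + κ)) := by positivity
  have hV0 : 0 ≤ V := by positivity
  refine ⟨√V, Real.le_sqrt_of_sq_le (by nlinarith), ?_, ?_⟩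
  · rw [Real.sq_sqrt hV0, hV]
    nlinarith [sq_nonneg (t + 1)]
  · rw [Real.sq_sqrt hV0]
    have h1 : (t + 1) ^ 2 ≤ (τ + 1) ^ 2 * x ^ (2 + 2 * κ) := by
      calc (t + 1) ^ 2 ≤ ((τ + 1) * x) ^ 2 := by gcongr; linarith
        _ = (τ + 1) ^ 2 * x ^ 2 := by ring
        _ ≤ _ := by gcongr
    have h2 : c₁ * (1 + Real.log (1 + (L + 1) / s l) ^ (1 + κ))
        ≤ c₁ * (x ^ (2 + 2 * κ) + A ^ (1 + κ) * x ^ (2 + 2 * κ)) := by gcongr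
    have h3 : s l ≤ Cs * x ^ (2 + 2 * κ) := hsC.trans (le_mul_of_one_le_right (by linarith) hx1)
    rw [hV]
    nlinarith

/-- A geometric series started at the first level `J` with 2^J ≥ y. -/
theorem tsum_high_levels_le {β y : ℝ} (hβ : 0 < β) (hy : 0 < y) :
    ∑' l : ℕ, ENNReal.ofReal (if y ≤ (2 : ℝ) ^ l then ((2 : ℝ) ^ l) ^ (-(2 * β)) else 0)
      ≤ ENNReal.ofReal (y ^ (-(2 * β)) * (1 - (2 : ℝ) ^ (-(2 * β)))⁻¹) := by
  have hex : ∃ J : ℕ, y ≤ (2 : ℝ) ^ J :=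
    (pow_unbounded_of_one_lt y (by norm_num : (1 : ℝ) < 2)).imp fun _ h => h.le
  classical
  set J := Nat.find hex with hJ
  have hq0 : 0 ≤ (2 : ℝ) ^ (-(2 * β)) := by positivity
  have hq1 : (2 : ℝ) ^ (-(2 * β)) < 1 :=
    Real.rpow_lt_one_of_one_lt_of_neg (by norm_num) (by linarith)
  rw [← (ENNReal.summable.sum_add_tsum_nat_add' (k := J)), Finset.sum_eq_zero, zero_add]
  · calc _ ≤ ∑' l : ℕ, ENNReal.ofReal (y ^ (-(2 * β)) * ((2 : ℝ) ^ (-(2 * β))) ^ l) := by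
          refine ENNReal.tsum_le_tsum fun l => ENNReal.ofReal_le_ofReal ?_
          have hb : ((2 : ℝ) ^ (l + J)) ^ (-(2 * β))
              = ((2 : ℝ) ^ J) ^ (-(2 * β)) * ((2 : ℝ) ^ (-(2 * β))) ^ l := by
            rw [pow_add, Real.mul_rpow (by positivity) (by positivity), mul_comm]
            congr 1
            rw [← two_rpow_mul_natCast, ← Real.rpow_natCast, ← Real.rpow_mul (by norm_num)]
          have hJy : ((2 : ℝ) ^ J) ^ (-(2 * β)) ≤ y ^ (-(2 * β)) :=
            Real.rpow_le_rpow_of_nonpos hy (Nat.find_spec hex) (by linarith)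
          split_ifs with h
          · rw [hb]; gcongr
          · positivity
      _ = _ := by
          rw [← ENNReal.ofReal_tsum_of_nonneg (fun l => by positivity)
            ((summable_geometric_of_lt_one hq0 hq1).mul_left _), tsum_mul_left,
            tsum_geometric_of_lt_one hq0 hq1]
  · intro l hl
    rw [if_neg (Nat.find_min hex (Finset.mem_range.1 hl)), ENNReal.ofReal_zero]

theorem tsum_low_levels_le {M W : ℝ} (hM : 0 ≤ M) (hW : 0 ≤ W) :
    ∑' l : ℕ, ENNReal.ofReal (if (l : ℝ) ≤ M then W else 0)
      ≤ ENNReal.ofReal ((M + 1) * W) := by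
  rw [tsum_eq_sum (s := Finset.range (⌊M⌋₊ + 1)) fun l hl => by
    rw [if_neg, ENNReal.ofReal_zero]
    intro h
    exact hl (Finset.mem_range.2 (Nat.lt_succ_of_le (Nat.le_floor h)))]
  rw [← ENNReal.ofReal_sum_of_nonneg fun l _ => by split_ifs <;> simp [hW]]
  refine ENNReal.ofReal_le_ofReal ?_
  calc ∑ l ∈ Finset.range (⌊M⌋₊ + 1), (if (l : ℝ) ≤ M then W else 0)
      ≤ ∑ l ∈ Finset.range (⌊M⌋₊ + 1), W :=
        Finset.sum_le_sum fun l _ => by split_ifs <;> simp [hW]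
    _ = (⌊M⌋₊ + 1) * W := by simp
    _ ≤ _ := by gcongr; exact Nat.floor_le hM

/-! ### Summation of the coordinate risks over all levels. -/

section RiskSummation

variable {β L r : ℝ} (hβ : 0 < β) (hL : 0 < L) (hr₁ : 1 ≤ r) (hr₂ : r ≤ 2)
  (hβr : 1 / r - 1 / 2 < β) {a : WaveletIndex → ℝ}
  (ha : ∑' l : ℕ, ENNReal.ofReal ((2 : ℝ) ^ (r * l * (β + 1 / 2 - 1 / r))
    * ∑ k : Fin (2 ^ l), |a ⟨l, k⟩| ^ r) < ENNReal.ofReal (L ^ r))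
  {n : ℕ} (hn : n ≠ 0) (hx : 1 ≤ Real.log n) {F : WaveletIndex → ℝ≥0∞} {Λ U K : ℝ}
  (hΛ : (2 * β + 1)⁻¹ / Real.log 2 ≤ Λ) (hU : 0 ≤ U) (hK : 0 ≤ K)
  (hlarge : ∀ i, 1 / (√n * truncRadius n i.1) < |a i| → (i.1 : ℝ) ≤ Λ * Real.log n)
  (hnear : ∀ i, (i.1 : ℝ) ≤ Λ * Real.log n → F i ≤ ENNReal.ofReal U)
  (hsmall : ∀ i, (n : ℝ) ^ (2 * β + 1)⁻¹ ≤ 2 ^ i.1 → |a i| ≤ 1 / (√n * truncRadius n i.1) →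
    F i ≤ ENNReal.ofReal (2 * a i ^ 2 + K * ((2 : ℝ) ^ i.1) ^ (-(2 * β + 1))))

include hβ hL hr₁ hr₂ hβr ha hn hx hΛ hU hK hlarge hnear hsmall

theorem sum_level_risk_le (l : ℕ) :
    ∑ k : Fin (2 ^ l), F ⟨l, k⟩
      ≤ ENNReal.ofReal (if (l : ℝ) ≤ Λ * Real.log n then
          (n : ℝ) ^ (2 * β + 1)⁻¹ * (1 + L ^ r * (2 * (2 + Λ) * Real.log n) ^ 2) * U else 0)
        + ENNReal.ofReal K * ENNReal.ofReal (if (n : ℝ) ^ (2 * β + 1)⁻¹ ≤ (2 : ℝ) ^ l then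
          ((2 : ℝ) ^ l) ^ (-(2 * β)) else 0)
        + ENNReal.ofReal (2 * (n : ℝ) ^ ((2 * β + 1)⁻¹ - 1))
          * ENNReal.ofReal ((2 : ℝ) ^ (r * l * (β + 1 / 2 - 1 / r))
            * ∑ k : Fin (2 ^ l), |a ⟨l, k⟩| ^ r) := by
  classical
  have hn' : (0 : ℝ) < n := by positivity
  set x := Real.log n with hxdef
  set N := (n : ℝ) ^ (2 * β + 1)⁻¹ with hN
  have hN0 : 0 < N := by positivity
  have hΛ0 : 0 ≤ Λ := le_trans (by positivity) hΛ
  -- Below the cutoff `N` every coefficient takes the bound `U`; above it, only the large ones do.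
  rcases lt_or_ge ((2 : ℝ) ^ l) N with hl | hl
  · have hlx : (l : ℝ) ≤ Λ * x :=
      (level_le_mul_log_of_low hn hl).trans (by gcongr)
    rw [if_pos hlx]
    refine le_trans ?_ (le_trans le_self_add le_self_add)
    calc ∑ k : Fin (2 ^ l), F ⟨l, k⟩ ≤ ∑ _k : Fin (2 ^ l), ENNReal.ofReal U :=
          Finset.sum_le_sum fun k _ => hnear ⟨l, k⟩ hlx
      _ = ENNReal.ofReal (2 ^ l * U) := by
          rw [Finset.sum_const, Finset.card_univ, Fintype.card_fin, nsmul_eq_mul,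
            ENNReal.ofReal_mul (by positivity)]
          simp [ENNReal.ofReal_pow]
      _ ≤ _ := by
          refine ENNReal.ofReal_le_ofReal ?_
          gcongr
          have : 0 ≤ L ^ r * (2 * (2 + Λ) * x) ^ 2 := by positivity
          nlinarith
  · rw [if_pos hl]
    set A := Finset.univ.filter fun k : Fin (2 ^ l) => 1 / (√n * truncRadius n l) < |a ⟨l, k⟩|
      with hA
    set B := Finset.univ.filter fun k : Fin (2 ^ l) => |a ⟨l, k⟩| ≤ 1 / (√n * truncRadius n l)
      with hB
    have hAB : ∑ k : Fin (2 ^ l), F ⟨l, k⟩ = ∑ k ∈ A, F ⟨l, k⟩ + ∑ k ∈ B, F ⟨l, k⟩ := by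
      rw [← Finset.sum_filter_add_sum_filter_not Finset.univ
        fun k : Fin (2 ^ l) => 1 / (√n * truncRadius n l) < |a ⟨l, k⟩|]
      simp only [not_lt, hA, hB]
    rw [hAB, add_assoc]
    refine add_le_add ?_ ?_
    · rcases A.eq_empty_or_nonempty with hAe | ⟨k₀, hk₀⟩
      · rw [hAe, Finset.sum_empty]; exact zero_le
      · have hlx : (l : ℝ) ≤ Λ * x := hlarge ⟨l, k₀⟩ (Finset.mem_filter.1 hk₀).2
        rw [if_pos hlx]
        have hcard := card_large_le hβ hL hr₁ hβr ha hn hr₂ hl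
        calc ∑ k ∈ A, F ⟨l, k⟩ ≤ ∑ _k ∈ A, ENNReal.ofReal U :=
              Finset.sum_le_sum fun k _ => hnear ⟨l, k⟩ hlx
          _ = ENNReal.ofReal (A.card * U) := by
              rw [Finset.sum_const, nsmul_eq_mul, ENNReal.ofReal_mul (by positivity)]
              simp
          _ ≤ _ := by
              refine ENNReal.ofReal_le_ofReal ?_
              gcongr
              refine hcard.trans ?_
              have ht := truncRadius_le_mul_log hx hlx
              have ht0 := two_le_truncRadius n l
              gcongr
              calc L ^ r * truncRadius n l ^ 2 ≤ L ^ r * (2 * (2 + Λ) * x) ^ 2 := by gcongr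
                _ ≤ _ := by linarith
    · have h1 := sum_sq_small_le (a := a) hβ hr₁ hβr hn hr₂ hl
      set b := (2 : ℝ) ^ (r * l * (β + 1 / 2 - 1 / r)) * ∑ k : Fin (2 ^ l), |a ⟨l, k⟩| ^ r
      have hpow : (2 : ℝ) ^ l * ((2 : ℝ) ^ l) ^ (-(2 * β + 1)) = ((2 : ℝ) ^ l) ^ (-(2 * β)) := by
        nth_rewrite 1 [← Real.rpow_one ((2 : ℝ) ^ l)]
        rw [← Real.rpow_add (by positivity)]
        congr 1; ring
      calc ∑ k ∈ B, F ⟨l, k⟩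
          ≤ ∑ k ∈ B, ENNReal.ofReal
              (2 * a ⟨l, k⟩ ^ 2 + K * ((2 : ℝ) ^ l) ^ (-(2 * β + 1))) :=
            Finset.sum_le_sum fun k hk => hsmall ⟨l, k⟩ hl (Finset.mem_filter.1 hk).2
        _ = ENNReal.ofReal (2 * ∑ k ∈ B, a ⟨l, k⟩ ^ 2
              + B.card * (K * ((2 : ℝ) ^ l) ^ (-(2 * β + 1)))) := by
            rw [← ENNReal.ofReal_sum_of_nonneg fun k _ => by positivity,
              Finset.sum_add_distrib, Finset.mul_sum, Finset.sum_const, nsmul_eq_mul]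
        _ ≤ ENNReal.ofReal (K * ((2 : ℝ) ^ l) ^ (-(2 * β))
              + 2 * (n : ℝ) ^ ((2 * β + 1)⁻¹ - 1) * b) := by
            refine ENNReal.ofReal_le_ofReal ?_
            have hcB : (B.card : ℝ) ≤ 2 ^ l := by
              have : B.card ≤ 2 ^ l := by simpa using Finset.card_le_univ B
              exact_mod_cast this
            have h2 : B.card * (K * ((2 : ℝ) ^ l) ^ (-(2 * β + 1)))
                ≤ K * ((2 : ℝ) ^ l) ^ (-(2 * β)) := by
              calc _ ≤ (2 : ℝ) ^ l * (K * ((2 : ℝ) ^ l) ^ (-(2 * β + 1))) := by gcongr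
                _ = K * ((2 : ℝ) ^ l * ((2 : ℝ) ^ l) ^ (-(2 * β + 1))) := by ring
                _ = _ := by rw [hpow]
            linarith
        _ = _ := by
            rw [ENNReal.ofReal_add (by positivity) (by positivity),
              ENNReal.ofReal_mul hK, ENNReal.ofReal_mul (by positivity)]

theorem tsum_risk_le :
    ∑' i, F i ≤ ENNReal.ofReal ((Λ * Real.log n + 1) *
        ((n : ℝ) ^ (2 * β + 1)⁻¹ * (1 + L ^ r * (2 * (2 + Λ) * Real.log n) ^ 2) * U)
      + K * ((n : ℝ) ^ ((2 * β + 1)⁻¹ - 1) * (1 - (2 : ℝ) ^ (-(2 * β)))⁻¹)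
      + 2 * (n : ℝ) ^ ((2 * β + 1)⁻¹ - 1) * L ^ r) := by
  have hn' : (0 : ℝ) < n := by positivity
  have hΛ0 : 0 ≤ Λ := le_trans (by positivity) hΛ
  have hq1 : (2 : ℝ) ^ (-(2 * β)) < 1 :=
    Real.rpow_lt_one_of_one_lt_of_neg (by norm_num) (by linarith)
  have hq2 : 0 < (1 - (2 : ℝ) ^ (-(2 * β)))⁻¹ := inv_pos.2 (by linarith)
  have hN : ((n : ℝ) ^ (2 * β + 1)⁻¹) ^ (-(2 * β)) = (n : ℝ) ^ ((2 * β + 1)⁻¹ - 1) := by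
    rw [← Real.rpow_mul hn'.le]
    congr 1
    field_simp
    ring
  have hhigh := tsum_high_levels_le hβ (y := (n : ℝ) ^ (2 * β + 1)⁻¹) (by positivity)
  rw [hN] at hhigh
  rw [ENNReal.tsum_sigma']
  simp_rw [tsum_fintype]
  refine (ENNReal.tsum_le_tsum (sum_level_risk_le hβ hL hr₁ hr₂ hβr ha hn hx hΛ hU hK hlarge
    hnear hsmall)).trans ?_
  rw [ENNReal.tsum_add, ENNReal.tsum_add, ENNReal.tsum_mul_left, ENNReal.tsum_mul_left,
    ENNReal.ofReal_add (by positivity) (by positivity),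
    ENNReal.ofReal_add (by positivity) (by positivity), ENNReal.ofReal_mul hK,
    ENNReal.ofReal_mul (p := 2 * (n : ℝ) ^ ((2 * β + 1)⁻¹ - 1)) (by positivity)]
  gcongr
  exact tsum_low_levels_le (by positivity) (by positivity)

end RiskSummation

theorem IsAdmissibleScale.summable_sq {s : ℕ → ℝ} {β C : ℝ} (hs : IsAdmissibleScale s β C)
    (hβ : 0 < β) : Summable fun i : WaveletIndex => s i.1 ^ 2 := by
  have hq0 : 0 ≤ (2 : ℝ) ^ (-(2 * β)) := by positivity
  have hq1 : (2 : ℝ) ^ (-(2 * β)) < 1 :=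
    Real.rpow_lt_one_of_one_lt_of_neg (by norm_num) (by linarith)
  rw [summable_sigma_of_nonneg fun _ => sq_nonneg _]
  refine ⟨fun l => Summable.of_finite, ?_⟩
  refine Summable.of_nonneg_of_le (fun l => tsum_nonneg fun _ => sq_nonneg _) (fun l => ?_)
    ((summable_geometric_of_lt_one hq0 hq1).mul_left (C ^ 2))
  simp only
  rw [tsum_fintype, Finset.sum_const, Finset.card_univ, Fintype.card_fin, nsmul_eq_mul]
  have h1 : s l ^ 2 ≤ (C * ((2 : ℝ) ^ l) ^ (-(1 / 2 + β))) ^ 2 := by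
    have := (hs.pos l).le
    gcongr
    exact hs.le l
  have h2 : (2 : ℝ) ^ l * (((2 : ℝ) ^ l) ^ (-(1 / 2 + β))) ^ 2 = ((2 : ℝ) ^ (-(2 * β))) ^ l := by
    rw [← Real.rpow_natCast _ 2, ← Real.rpow_mul (by positivity),
      ← Real.rpow_natCast _ l, ← Real.rpow_natCast _ l, ← Real.rpow_mul (by norm_num),
      ← Real.rpow_mul (by norm_num), ← Real.rpow_add (by norm_num)]
    congr 1; push_cast; ring
  push_cast
  calc (2 : ℝ) ^ l * s l ^ 2 ≤ 2 ^ l * (C * ((2 : ℝ) ^ l) ^ (-(1 / 2 + β))) ^ 2 := by gcongr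
    _ = C ^ 2 * (2 ^ l * (((2 : ℝ) ^ l) ^ (-(1 / 2 + β))) ^ 2) := by ring
    _ = _ := by rw [h2]

/-! ### Posterior contraction for admissible scales. -/

section Contraction

variable {H : Measure ℝ} [IsProbabilityMeasure H] {h : ℝ → ℝ} {c₁ κ : ℝ} (hc₁ : 0 < c₁)
  (hκ : 0 ≤ κ) (hH : H = volume.withDensity fun x => ENNReal.ofReal (h x))
  (hh : IsHeavyTailed h c₁ κ) (hmom : ∫⁻ z, ENNReal.ofReal (z ^ 2) ∂H ≠ ∞)
  {β L r : ℝ} (hβ : 0 < β) (hL : 0 < L) (hr₁ : 1 ≤ r) (hr₂ : r ≤ 2)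
  (hβr : 1 / r - 1 / 2 < β) {s : ℕ → ℝ} {C : ℝ} (hs : IsAdmissibleScale s β C)

include hc₁ hκ hH hh hmom hβ hL hr₁ hr₂ hβr hs

/-- The logarithmic exponent 5 + 2κ collects 1 from the number of levels, 2 from the count of large
coefficients, and 2 + 2κ from the risk threshold. -/
theorem exists_tsum_truncated_risk_le {a : WaveletIndex → ℝ}
    (ha : ∑' l : ℕ, ENNReal.ofReal ((2 : ℝ) ^ (r * l * (β + 1 / 2 - 1 / r))
      * ∑ k : Fin (2 ^ l), |a ⟨l, k⟩| ^ r) < ENNReal.ofReal (L ^ r)) :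
    ∃ M : ℝ, ∀ n : ℕ, n ≠ 0 → 1 ≤ Real.log n →
      ∑' i : WaveletIndex, ∫⁻ y in {y | |y - a i| ≤ truncRadius n i.1 / √n},
        coordPosterior H (s i.1) (n : ℝ≥0)⁻¹ (fun θ => ENNReal.ofReal ((θ - a i) ^ 2)) y
        ∂(gaussianReal (a i) (n : ℝ≥0)⁻¹)
      ≤ ENNReal.ofReal (M * (Real.log n ^ (5 + 2 * κ) * (n : ℝ) ^ ((2 * β + 1)⁻¹ - 1))) := by
  have hδ : 0 < β + 1 / 2 - 1 / r := by linarith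
  have hlog2 : 0 < Real.log 2 := Real.log_pos (by norm_num)
  obtain ⟨Λ₀, hΛ₀⟩ := exists_level_le_mul_log hδ hL
  set Λ := max Λ₀ ((2 * β + 1)⁻¹ / Real.log 2) with hΛdef
  have hΛ : (2 * β + 1)⁻¹ / Real.log 2 ≤ Λ := le_max_right _ _
  have hΛ0 : 0 ≤ Λ := le_trans (by positivity) hΛ
  obtain ⟨CU, hCU0, hCU⟩ := hs.exists_threshold hβ hc₁ hκ hL hΛ0
  set m := (∫⁻ z, ENNReal.ofReal (z ^ 2) ∂H).toReal with hm
  have hm0 : 0 ≤ m := ENNReal.toReal_nonneg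
  have hC := hs.one_le
  have hh1 := hh.pos 1
  set K := 2 * Real.exp (2 + C ^ 2 / 2) / h 1 * m * C ^ 2 with hK
  have hK0 : 0 ≤ K := by positivity
  have hq1 : (2 : ℝ) ^ (-(2 * β)) < 1 :=
    Real.rpow_lt_one_of_one_lt_of_neg (by norm_num) (by linarith)
  have hq2 : 0 < (1 - (2 : ℝ) ^ (-(2 * β)))⁻¹ := inv_pos.2 (by linarith)
  set τ := 2 * (2 + Λ) with hτ
  have hτ0 : 0 ≤ τ := by positivity
  refine ⟨(Λ + 1) * ((1 + L ^ r * τ ^ 2) * CU) + K * (1 - (2 : ℝ) ^ (-(2 * β)))⁻¹ + 2 * L ^ r,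
    fun n hn hx => ?_⟩
  have hn' : (0 : ℝ) < n := by positivity
  have hs0 : 0 < √(n : ℝ) := Real.sqrt_pos.2 hn'
  set x := Real.log n with hxdef
  have hx0 : 0 < x := by linarith
  have hCUn : 0 ≤ CU * x ^ (2 + 2 * κ) / n := by positivity
  have hlarge : ∀ i : WaveletIndex, 1 / (√n * truncRadius n i.1) < |a i| →
      (i.1 : ℝ) ≤ Λ * x := by
    intro i hi
    have h1 := two_rpow_mul_abs_lt hL hr₁ ha i
    have ht := two_le_truncRadius n i.1
    have ht0 : 0 < √n * truncRadius n i.1 := by positivity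
    refine (hΛ₀ n i.1 hn hx ?_).trans (by gcongr; exact le_max_left _ _)
    rw [div_lt_iff₀ ht0] at hi
    calc ((2 : ℝ) ^ i.1) ^ (β + 1 / 2 - 1 / r)
        = ((2 : ℝ) ^ i.1) ^ (β + 1 / 2 - 1 / r) * 1 := (mul_one _).symm
      _ ≤ ((2 : ℝ) ^ i.1) ^ (β + 1 / 2 - 1 / r) * (|a i| * (√n * truncRadius n i.1)) := by
          gcongr
      _ = (((2 : ℝ) ^ i.1) ^ (β + 1 / 2 - 1 / r) * |a i|) * (√n * truncRadius n i.1) := by ring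
      _ < _ := by gcongr
  refine (tsum_risk_le hβ hL hr₁ hr₂ hβr ha hn hx (U := CU * x ^ (2 + 2 * κ) / n) hΛ hCUn hK0
    hlarge ?_ ?_).trans (ENNReal.ofReal_le_ofReal ?_)
  · intro i hi
    obtain ⟨T, hT1, hT2, hT3⟩ := hCU n i.1 hx hi
    calc _ ≤ ∫⁻ y in {y | |y - a i| ≤ truncRadius n i.1 / √n},
          ENNReal.ofReal (CU * x ^ (2 + 2 * κ) / n) ∂(gaussianReal (a i) (n : ℝ≥0)⁻¹) := by
          refine setLIntegral_mono' (measurableSet_le (by fun_prop) measurable_const) fun y hy => ?_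
          refine (coordPosterior_sq_sub_le hH hh hn (hs.pos i.1)
            (abs_le_of_besov hL hr₁ hβr ha i) hy hT1 hT2).trans (ENNReal.ofReal_le_ofReal ?_)
          gcongr
      _ ≤ _ := by
          rw [setLIntegral_const]
          exact mul_le_of_le_one_right' prob_le_one
  · intro i hi hai
    -- The scale bound drops below the noise level 1/√n exactly at the cutoff 2^l = N.
    have hNs : ((2 : ℝ) ^ i.1) ^ (-(1 / 2 + β)) * √n ≤ 1 := by
      have h1 : ((2 : ℝ) ^ i.1) ^ (-(1 / 2 + β)) ≤ ((n : ℝ) ^ (2 * β + 1)⁻¹) ^ (-(1 / 2 + β)) :=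
        Real.rpow_le_rpow_of_nonpos (by positivity) hi (by linarith)
      have h2 : ((n : ℝ) ^ (2 * β + 1)⁻¹) ^ (-(1 / 2 + β)) = (√n)⁻¹ := by
        rw [← Real.rpow_mul hn'.le, Real.sqrt_eq_rpow, ← Real.rpow_neg hn'.le]
        congr 1
        field_simp
        ring
      rw [h2] at h1
      calc _ ≤ (√(n : ℝ))⁻¹ * √n := by gcongr
        _ = 1 := inv_mul_cancel₀ hs0.ne'
    have hsC : s i.1 * √n ≤ C := by
      calc s i.1 * √n ≤ C * ((2 : ℝ) ^ i.1) ^ (-(1 / 2 + β)) * √n := by gcongr; exact hs.le i.1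
        _ = C * (((2 : ℝ) ^ i.1) ^ (-(1 / 2 + β)) * √n) := by ring
        _ ≤ C * 1 := by gcongr
        _ = C := mul_one C
    refine (setLIntegral_coordPosterior_sq_sub_le hH hh hn hmom (hs.pos i.1) hsC
      (by linarith [two_le_truncRadius n i.1]) hai).trans (ENNReal.ofReal_le_ofReal ?_)
    have h2 : s i.1 ^ 2 ≤ C ^ 2 * ((2 : ℝ) ^ i.1) ^ (-(2 * β + 1)) := by
      calc s i.1 ^ 2 ≤ (C * ((2 : ℝ) ^ i.1) ^ (-(1 / 2 + β))) ^ 2 := by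
            have := (hs.pos i.1).le
            gcongr
            exact hs.le i.1
        _ = _ := by
            rw [mul_pow, ← Real.rpow_natCast _ 2, ← Real.rpow_natCast (((2 : ℝ) ^ i.1) ^ _) 2,
              ← Real.rpow_mul (by positivity)]
            congr 2
            push_cast; ring
    have h3 : 0 ≤ 2 * Real.exp (2 + C ^ 2 / 2) / h 1 * m := by positivity
    calc 2 * a i ^ 2 + 2 * Real.exp (2 + C ^ 2 / 2) / h 1 * m * s i.1 ^ 2
        ≤ 2 * a i ^ 2 + 2 * Real.exp (2 + C ^ 2 / 2) / h 1 * m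
          * (C ^ 2 * ((2 : ℝ) ^ i.1) ^ (-(2 * β + 1))) := by gcongr
      _ = _ := by rw [hK]; ring
  · have hN : (n : ℝ) ^ (2 * β + 1)⁻¹ = (n : ℝ) ^ ((2 * β + 1)⁻¹ - 1) * n := by
      rw [Real.rpow_sub_one hn'.ne']; field_simp
    set R := (n : ℝ) ^ ((2 * β + 1)⁻¹ - 1) with hR
    have hR0 : 0 < R := by positivity
    have hP1 : 1 ≤ x ^ (5 + 2 * κ) := Real.one_le_rpow hx (by linarith)
    have hP : x ^ (5 + 2 * κ) = x * x ^ 2 * x ^ (2 + 2 * κ) := by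
      rw [← Real.rpow_natCast x 2]
      nth_rewrite 2 [← Real.rpow_one x]
      rw [← Real.rpow_add hx0, ← Real.rpow_add hx0]
      congr 1; push_cast; ring
    have e1 : (Λ * x + 1) * ((n : ℝ) ^ (2 * β + 1)⁻¹ * (1 + L ^ r * (τ * x) ^ 2)
          * (CU * x ^ (2 + 2 * κ) / n))
        ≤ (Λ + 1) * ((1 + L ^ r * τ ^ 2) * CU) * (x ^ (5 + 2 * κ) * R) := by
      have h1 : Λ * x + 1 ≤ (Λ + 1) * x := by linarith
      have h2 : 1 + L ^ r * (τ * x) ^ 2 ≤ (1 + L ^ r * τ ^ 2) * x ^ 2 := by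
        have : 1 ≤ x ^ 2 := one_le_pow₀ hx
        nlinarith
      calc _ ≤ ((Λ + 1) * x) * ((n : ℝ) ^ (2 * β + 1)⁻¹ * ((1 + L ^ r * τ ^ 2) * x ^ 2)
            * (CU * x ^ (2 + 2 * κ) / n)) := by gcongr
        _ = _ := by rw [hN, hP]; field_simp
    have hRP : R ≤ x ^ (5 + 2 * κ) * R := le_mul_of_one_le_left hR0.le hP1
    have e2 : K * (R * (1 - (2 : ℝ) ^ (-(2 * β)))⁻¹)
        ≤ K * (1 - (2 : ℝ) ^ (-(2 * β)))⁻¹ * (x ^ (5 + 2 * κ) * R) := by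
      calc _ = K * (1 - (2 : ℝ) ^ (-(2 * β)))⁻¹ * R := by ring
        _ ≤ _ := by gcongr
    have e3 : 2 * R * L ^ r ≤ 2 * L ^ r * (x ^ (5 + 2 * κ) * R) := by
      calc _ = 2 * L ^ r * R := by ring
        _ ≤ _ := by gcongr
    calc _ ≤ (Λ + 1) * ((1 + L ^ r * τ ^ 2) * CU) * (x ^ (5 + 2 * κ) * R)
          + K * (1 - (2 : ℝ) ^ (-(2 * β)))⁻¹ * (x ^ (5 + 2 * κ) * R)
          + 2 * L ^ r * (x ^ (5 + 2 * κ) * R) := add_le_add (add_le_add e1 e2) e3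
      _ = _ := by ring

theorem tendsto_expectedPosteriorMass (ψ : WaveletBasis) {f₀ : L2I}
    (hf₀ : f₀ ∈ besovBall ψ β r L) :
    Tendsto (fun n : ℕ => expectedPosteriorMass ψ s H n f₀
      ((Real.log n) ^ (3 + κ) * (n : ℝ) ^ (-β / (2 * β + 1)))) atTop (𝓝 0) := by
  obtain ⟨M, hM⟩ := exists_tsum_truncated_risk_le hc₁ hκ hH hh hmom hβ hL hr₁ hr₂ hβr hs
    (a := coeff ψ f₀) hf₀
  have hlog : Tendsto (fun n : ℕ => Real.log n) atTop atTop :=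
    Real.tendsto_log_atTop.comp tendsto_natCast_atTop_atTop
  have hbound : ∀ᶠ n : ℕ in atTop, expectedPosteriorMass ψ s H n f₀
      ((Real.log n) ^ (3 + κ) * (n : ℝ) ^ (-β / (2 * β + 1)))
      ≤ ENNReal.ofReal (4 / n) + ENNReal.ofReal (M / Real.log n) := by
    filter_upwards [hlog.eventually_ge_atTop 1, eventually_ne_atTop 0] with n hx hn
    have hn' : (0 : ℝ) < n := by positivity
    set x := Real.log n with hxdef
    have hx0 : 0 < x := by linarith
    refine (expectedPosteriorMass_le ψ (hs.summable_sq hβ) H hmom hn f₀ (by positivity)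
      (fun i => truncRadius n i.1 / √n)).trans
      (add_le_add (tsum_gaussianReal_tail_le _ hn) ?_)
    refine (mul_le_mul_right (hM n hn hx) _).trans (le_of_eq ?_)
    rw [← ENNReal.ofReal_inv_of_pos (by positivity), ← ENNReal.ofReal_mul (by positivity)]
    congr 1
    -- The exponent 3 + κ leaves one spare logarithm beyond the risk bound, which sends the ratio to
    -- 0.
    have e1 : (x ^ (3 + κ)) ^ 2 = x ^ (5 + 2 * κ) * x := by
      rw [← Real.rpow_natCast _ 2, ← Real.rpow_mul hx0.le, ← Real.rpow_add_one hx0.ne']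
      congr 1; push_cast; ring
    have e2 : ((n : ℝ) ^ (-β / (2 * β + 1))) ^ 2 = (n : ℝ) ^ ((2 * β + 1)⁻¹ - 1) := by
      rw [← Real.rpow_natCast _ 2, ← Real.rpow_mul hn'.le]
      congr 1; push_cast; field_simp; ring
    rw [mul_pow, e1, e2, ← hxdef]
    field_simp
  refine tendsto_of_tendsto_of_tendsto_of_le_of_le' tendsto_const_nhds ?_
    (Eventually.of_forall fun _ => zero_le) hbound
  have h1 : Tendsto (fun n : ℕ => (4 : ℝ) / n) atTop (𝓝 0) :=
    tendsto_const_nhds.div_atTop tendsto_natCast_atTop_atTop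
  have h2 : Tendsto (fun n : ℕ => M / Real.log n) atTop (𝓝 0) :=
    tendsto_const_nhds.div_atTop hlog
  simpa using (ENNReal.tendsto_ofReal h1).add (ENNReal.tendsto_ofReal h2)

end Contraction

/-! ### The two families of scales are admissible, and the conclusion. -/

theorem isAdmissibleScale_otScale {β : ℝ} (hβ : 0 < β) :
    ∃ C, IsAdmissibleScale otScale β C := by
  have h2 : Real.log 2 ≤ 1 := by
    have := Real.log_le_sub_one_of_pos (show (0 : ℝ) < 2 by norm_num); linarith
  refine ⟨(2 : ℝ) ^ ((1 / 2 + β) ^ 2), Real.one_le_rpow (by norm_num) (by positivity),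
    fun l => by unfold otScale; positivity, fun l => ?_, fun l => ?_⟩
  · rw [otScale, ← two_rpow_mul_natCast, ← Real.rpow_add (by norm_num)]
    refine Real.rpow_le_rpow_of_exponent_le (by norm_num) ?_
    -- With b = 1/2 + β this is b l ≤ l² + b², which explains the constant 2^(b²).
    nlinarith [sq_nonneg ((l : ℝ) - (1 / 2 + β)), sq_nonneg (l : ℝ), sq_nonneg (1 / 2 + β)]
  · have hC : 1 ≤ (2 : ℝ) ^ ((1 / 2 + β) ^ 2) := Real.one_le_rpow (by norm_num) (by positivity)
    rw [otScale, Real.log_rpow (by norm_num)]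
    have hl : (0 : ℝ) ≤ l := by positivity
    have h0 : 0 ≤ Real.log 2 := Real.log_nonneg (by norm_num)
    calc -(-(l : ℝ) ^ 2 * Real.log 2) = (l : ℝ) ^ 2 * Real.log 2 := by ring
      _ ≤ (1 + (l : ℝ)) ^ 2 * 1 := by gcongr; linarith
      _ ≤ _ := by rw [mul_one]; exact le_mul_of_one_le_left (by positivity) hC

theorem isAdmissibleScale_htScale {α β : ℝ} (hβ : 0 < β) (hαβ : β ≤ α) :
    IsAdmissibleScale (htScale α) β (1 + α) := by
  have h2 : Real.log 2 ≤ 1 := by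
    have := Real.log_le_sub_one_of_pos (show (0 : ℝ) < 2 by norm_num); linarith
  have h0 : 0 ≤ Real.log 2 := Real.log_nonneg (by norm_num)
  refine ⟨by linarith, fun l => by unfold htScale; positivity, fun l => ?_, fun l => ?_⟩
  · have hl : (0 : ℝ) ≤ l := by positivity
    rw [htScale, ← two_rpow_mul_natCast]
    calc (2 : ℝ) ^ (-(l : ℝ) * (1 / 2 + α)) ≤ (2 : ℝ) ^ (-(1 / 2 + β) * l) :=
          Real.rpow_le_rpow_of_exponent_le (by norm_num) (by nlinarith)
      _ ≤ _ := le_mul_of_one_le_left (by positivity) (by linarith)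
  · rw [htScale, Real.log_rpow (by norm_num)]
    have hl : (0 : ℝ) ≤ l := by positivity
    calc -(-(l : ℝ) * (1 / 2 + α) * Real.log 2) = l * (1 / 2 + α) * Real.log 2 := by ring
      _ ≤ l * (1 / 2 + α) * 1 := by have : 0 ≤ 1 / 2 + α := by linarith
                                    gcongr
      _ ≤ (1 + α) * (1 + l) ^ 2 := by nlinarith [mul_nonneg (hβ.le.trans hαβ) hl]

theorem IsHeavyTailed.lintegral_sq_ne_top {h : ℝ → ℝ} {c₁ κ : ℝ} (hh : IsHeavyTailed h c₁ κ)
    (hmom : Integrable fun x => |x| ^ 2 * h x) :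
    ∫⁻ z, ENNReal.ofReal (z ^ 2) ∂(volume.withDensity fun x => ENNReal.ofReal (h x)) ≠ ∞ := by
  have hm : Measurable fun z : ℝ => ENNReal.ofReal (z ^ 2) := by fun_prop
  rw [lintegral_withDensity_eq_lintegral_mul _ hh.measurable.ennreal_ofReal hm]
  refine ne_top_of_le_ne_top hmom.lintegral_lt_top.ne (lintegral_mono fun z => ?_)
  rw [Pi.mul_apply, ← ENNReal.ofReal_mul (hh.pos z).le, sq_abs, mul_comm]

theorem theorem4
    (ψ : WaveletBasis)
    (H : Measure ℝ) [IsProbabilityMeasure H]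
    (h : ℝ → ℝ) (c₁ κ : ℝ) (hc₁ : 0 < c₁) (hκ : 0 ≤ κ)
    (hH : H = volume.withDensity fun x => ENNReal.ofReal (h x))
    (hh : IsHeavyTailed h c₁ κ)
    (hmom : Integrable fun x => |x| ^ 2 * h x)
    (β L r : ℝ) (hβ : 0 < β) (hL : 0 < L) (hr₁ : 1 ≤ r) (hr₂ : r ≤ 2)
    (hβr : 1 / r - 1 / 2 < β) :
    (∃ d : ℝ, 0 < d ∧ ∀ f₀ ∈ besovBall ψ β r L,
      Tendsto (fun n : ℕ => expectedPosteriorMass ψ otScale H n f₀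
          ((Real.log n) ^ d * (n : ℝ) ^ (-β / (2 * β + 1))))
        atTop (𝓝 0)) ∧
    (∀ α : ℝ, β ≤ α → ∃ d : ℝ, 0 < d ∧ ∀ f₀ ∈ besovBall ψ β r L,
      Tendsto (fun n : ℕ => expectedPosteriorMass ψ (htScale α) H n f₀
          ((Real.log n) ^ d * (n : ℝ) ^ (-β / (2 * β + 1))))
        atTop (𝓝 0)) := by
  have hmom' : ∫⁻ z, ENNReal.ofReal (z ^ 2) ∂H ≠ ∞ := by
    rw [hH]; exact hh.lintegral_sq_ne_top hmom
  refine ⟨⟨3 + κ, by linarith, fun f₀ hf₀ => ?_⟩,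
    fun α hα => ⟨3 + κ, by linarith, fun f₀ hf₀ => ?_⟩⟩
  · obtain ⟨C, hC⟩ := isAdmissibleScale_otScale hβ
    exact tendsto_expectedPosteriorMass hc₁ hκ hH hh hmom' hβ hL hr₁ hr₂ hβr hC ψ hf₀
  · exact tendsto_expectedPosteriorMass hc₁ hκ hH hh hmom' hβ hL hr₁ hr₂ hβr
      (isAdmissibleScale_htScale hβ hα) ψ hf₀
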